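/- **Theorem (efficiency of variance-stabilized leverage-weighted conformal prediction).** *Setting.* Fix $p\ge 0$, $\alpha\in(0,1)$, $\sigma>0$, $\beta^*\in\mathbb R^p$ and a continuous, strictly increasing $g:[0,\infty)\to(0,\infty)$. Let $X_0,X_1,\dots$ be an exchangeable sequence of random vectors in $\mathbb R^p$ and let $\eta_0,\eta_1,\dots$ be i.i.d. real random variables with law $F_\eta$, mean $0$ and variance $1$, independent of $(X_i)_i$. At stage $n$ there are $n_1=n_1(n)$ training points (indices $i<n_1$, forming $\mathcal D_1$), $n_2=n_2(n)$ calibration points ($n_1\le i<n_1+n_2$, forming $\mathcal D_2$), and one test point, with index $n_1+n_2$, written $(X_{n+1},Y_{n+1})$. With $\mathbf X_1$ the matrix whose rows are the training features, the leverage of $x\in\mathbb R^p$ is $h_n(x)=x^\top(\mathbf X_1^\top\mathbf X_1)^{-1}x$; assume $\mathbb P(\mathbf X_1^\top\mathbf X_1\text{ invertible})\to1$ (where it is singular, put $h_n=0$). The responses are $Y_i=X_i^\top\beta^*+\sigma\sqrt{g(h_n(X_i))}\,\eta_i$. The predictor is $\hat f(x)=x^\top\hat\beta$, with $\hat\beta=\hat\beta_n$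 a measurable function of $\mathcal D_1$. For a weight $w>0$ let $\hat q_w$ be the $\lceil(1-\alpha)(n_2+1)\rceil$-th smallest of the scores $|Y_i-\hat f(X_i)|\,w(h_n(X_i))$, $i\in\mathcal D_2$, and let $$\hat{\mathcal C}_n^w(x)=\bigl[\hat f(x)-\hat q_w/w(h_n(x)),\ \hat f(x)+\hat q_w/w(h_n(x))\bigr],\qquad |\hat{\mathcal C}_n^w(x)|=2\hat q_w/w(h_n(x)).$$ Let $w^*(h)=1/\sqrt{g(h)}$; the constant weight $w\equiv1$ gives vanilla CP. *Regularity.* As $n\to\infty$: $n_1,n_2\to\infty$; (a) $\|\hat\beta-\beta^*\|=O_p(1/\sqrt{n_1})$; (b) the empirical distribution of the leverages $h_n(X_i)$, $i\in\mathcal D_2$, converges weakly, in probability, to a probability measure $F_h$; (c) the distribution function of $F_\eta$ is continuous. *Conclusions.* 1. (Conditional coverage.) The conditional coverage given the leverage of the test point tends to $1-\alpha$, in the following senses. - $\mathbb E\bigl|\mathbb P(Y_{n+1}\in\hat{\mathcal C}_n^{w^*}(X_{n+1})\mid h_n(X_{n+1}))-(1-\alpha)\bigr|\to0$. - For $F_h$-a.e.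 $h$ and every $r>0$: $\mathbb P(|h_n(X_{n+1})-h|<r)>0$ for all large $n$, and $\mathbb P\bigl(Y_{n+1}\in\hat{\mathcal C}_n^{w^*}(X_{n+1})\,\big|\,|h_n(X_{n+1})-h|<r\bigr)\to1-\alpha$. - For $F_h$-a.e. $h$: $$\sup_{x:\,h_n(x)=h}\bigl|\mathbb P(Y_{n+1}\in\hat{\mathcal C}_n^{w^*}(X_{n+1})\mid\mathcal D_1,\mathcal D_2,X_{n+1}=x)-(1-\alpha)\bigr|\to0\quad\text{in probability,}$$ where the conditional probability is the $F_\eta$-measure of the set of all $e$ with $x^\top\beta^*+\sigma\sqrt{g(h_n(x))}\,e\in\hat{\mathcal C}_n^{w^*}(x)$. 2. (Width parity.) Assume in addition that the $(1-\alpha)$-quantile of $|\eta_0|$ is unique (exactly one $q$ satisfies $\mathbb P(|\eta_0|\le q)=1-\alpha$), that $\limsup_n\mathbb E[g(h_n(X_{n+1}))]<\infty$, and that $\mathbb E[(X_{n+1}^\top(\hat\beta-\beta^*))^2]\to0$. Then for all large $n$ both expected widths are finite and the vanilla one is positive, and $$\frac{\mathbb E\,|\hat{\mathcal C}_n^{w^*}(X_{n+1})|}{\mathbb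 E\,|\hat{\mathcal C}_n^{1}(X_{n+1})|}\longrightarrow1 .$$ -/

import Mathlib

open MeasureTheory ProbabilityTheory Filter Topology
open scoped Matrix ENNReal BoundedContinuousFunction

noncomputable section

namespace LWCP

/-- Gram matrix `X₁ᵀ X₁` of the design matrix `X₁` whose rows are `x 0, …, x (m-1)`. -/
def gram {p m : ℕ} (x : Fin m → EuclideanSpace ℝ (Fin p)) : Matrix (Fin p) (Fin p) ℝ :=
  (Matrix.of fun i j => x i j)ᵀ * Matrix.of fun i j => x i j

/-- Leverage `zᵀ (X₁ᵀ X₁)⁻¹ z` of the point `z` with respect to the design `x`. -/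
def leverage {p m : ℕ} (x : Fin m → EuclideanSpace ℝ (Fin p)) (z : EuclideanSpace ℝ (Fin p)) : ℝ :=
  z.ofLp ⬝ᵥ ((gram x)⁻¹ *ᵥ z.ofLp)

/-- The `k`-th smallest of the values `s 0, …, s (m-1)` (with multiplicity), for `1 ≤ k ≤ m`. -/
def kthSmallest {m : ℕ} (k : ℕ) (s : Fin m → ℝ) : ℝ :=
  sInf {t : ℝ | k ≤ (Finset.univ.filter fun i => s i ≤ t).card}

/-- A sequence of random variables is exchangeable if permuting it does not change its law. -/
def Exchangeable {Ω E : Type*} [MeasurableSpace Ω] [MeasurableSpace E]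
    (μ : Measure Ω) (X : ℕ → Ω → E) : Prop :=
  ∀ τ : Equiv.Perm ℕ, μ.map (fun ω i => X (τ i) ω) = μ.map (fun ω i => X i ω)

/-- `Z n = O_p(a n)`. -/
def IsBigOInProbability {Ω : Type*} [MeasurableSpace Ω] (μ : Measure Ω)
    (Z : ℕ → Ω → ℝ) (a : ℕ → ℝ) : Prop :=
  ∀ ε : ℝ≥0∞, 0 < ε → ∃ M : ℝ, ∀ᶠ n in atTop, μ {ω | M * a n < |Z n ω|} ≤ ε

/-- The random variables and parameters of split conformal prediction with a linear predictor.
At stage `n` the training set `D₁` consists of the points with index `< n₁ n`, the calibration set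
`D₂` of the next `n₂ n` points, and the test point has index `n₁ n + n₂ n`. -/
structure Setup (Ω : Type*) (p : ℕ) where
  /-- features -/
  X : ℕ → Ω → EuclideanSpace ℝ (Fin p)
  /-- standardized noise -/
  η : ℕ → Ω → ℝ
  /-- true coefficient vector -/
  βstar : EuclideanSpace ℝ (Fin p)
  /-- noise level -/
  σ : ℝ
  /-- scale function, used on `[0, ∞)` only -/
  g : ℝ → ℝ
  /-- size of the training set -/
  n₁ : ℕ → ℕ
  /-- size of the calibration set -/
  n₂ : ℕ → ℕ
  /-- the training algorithm: it maps the training set to the estimated coefficient vector -/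
  fit : ∀ n, (Fin (n₁ n) → EuclideanSpace ℝ (Fin p) × ℝ) → EuclideanSpace ℝ (Fin p)

namespace Setup

variable {Ω : Type*} {p : ℕ} (S : Setup Ω p)

/-- Training design at stage `n`. -/
def design (n : ℕ) (ω : Ω) : Fin (S.n₁ n) → EuclideanSpace ℝ (Fin p) := fun i => S.X i ω

/-- The leverage function `h` at stage `n`, computed from the training design. -/
def h (n : ℕ) (ω : Ω) (z : EuclideanSpace ℝ (Fin p)) : ℝ := leverage (S.design n ω) z

/-- A response at feature vector `x` with standardized noise `e`:
`xᵀ β* + σ √(g (h x)) e`. -/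
def response (n : ℕ) (ω : Ω) (x : EuclideanSpace ℝ (Fin p)) (e : ℝ) : ℝ :=
  inner ℝ x S.βstar + S.σ * √(S.g (S.h n ω x)) * e

/-- `Y_i = X_iᵀ β* + ε_i` with `ε_i = σ √(g (h (X_i))) η_i`. -/
def Y (n i : ℕ) (ω : Ω) : ℝ := S.response n ω (S.X i ω) (S.η i ω)

/-- The coefficient vector estimated from `D₁`. -/
def βhat (n : ℕ) (ω : Ω) : EuclideanSpace ℝ (Fin p) :=
  S.fit n fun i => (S.X i ω, S.Y n i ω)

/-- The predictor `f̂ (x) = xᵀ β̂`. -/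
def fhat (n : ℕ) (ω : Ω) (x : EuclideanSpace ℝ (Fin p)) : ℝ := inner ℝ x (S.βhat n ω)

/-- The score `|y - f̂ x| * w (h x)`. -/
def score (w : ℝ → ℝ) (n : ℕ) (ω : Ω) (x : EuclideanSpace ℝ (Fin p)) (y : ℝ) : ℝ :=
  |y - S.fhat n ω x| * w (S.h n ω x)

/-- The `⌈(1-α)(n₂+1)⌉`-th smallest calibration score. -/
def qhat (w : ℝ → ℝ) (α : ℝ) (n : ℕ) (ω : Ω) : ℝ :=
  kthSmallest ⌈(1 - α) * ((S.n₂ n : ℝ) + 1)⌉₊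
    fun i : Fin (S.n₂ n) => S.score w n ω (S.X (S.n₁ n + i) ω) (S.Y n (S.n₁ n + i) ω)

/-- The prediction interval at `x`. -/
def interval (w : ℝ → ℝ) (α : ℝ) (n : ℕ) (ω : Ω) (x : EuclideanSpace ℝ (Fin p)) : Set ℝ :=
  Set.Icc (S.fhat n ω x - S.qhat w α n ω / w (S.h n ω x))
    (S.fhat n ω x + S.qhat w α n ω / w (S.h n ω x))

/-- The width of the prediction interval at `x`. -/
def width (w : ℝ → ℝ) (α : ℝ) (n : ℕ) (ω : Ω) (x : EuclideanSpace ℝ (Fin p)) : ℝ :=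
  2 * S.qhat w α n ω / w (S.h n ω x)

/-- The variance-stabilized weight `w* = 1 / √g`. -/
def wstar (t : ℝ) : ℝ := 1 / √(S.g t)

/-- Index of the test point. -/
def testIdx (n : ℕ) : ℕ := S.n₁ n + S.n₂ n

/-- Features of the test point. -/
def Xtest (n : ℕ) (ω : Ω) : EuclideanSpace ℝ (Fin p) := S.X (S.testIdx n) ω

/-- Response of the test point. -/
def Ytest (n : ℕ) (ω : Ω) : ℝ := S.Y n (S.testIdx n) ω

/-- Leverage of the test point. -/
def htest (n : ℕ) (ω : Ω) : ℝ := S.h n ω (S.Xtest n ω)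

/-- The event that the test response lies in its prediction interval. -/
def covered (w : ℝ → ℝ) (α : ℝ) (n : ℕ) : Set Ω :=
  {ω | S.Ytest n ω ∈ S.interval w α n ω (S.Xtest n ω)}

variable [MeasurableSpace Ω] (μ : Measure Ω)

/-- Conditional probability, given that `D₁ ∪ D₂` is as in `ω` and that the test feature vector
is `x`, that the test response lies in the prediction interval (the noise of the test point is
independent of everything else and distributed as `η 0`). -/
def coverageAt (w : ℝ → ℝ) (α : ℝ) (n : ℕ) (ω : Ω) (x : EuclideanSpace ℝ (Fin p)) : ℝ :=
  (μ.map (S.η 0)).real {e | S.response n ω x e ∈ S.interval w α n ω x}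

/-- Linear model with leverage-dependent scale family (the identities for `Y` and `ε` are built
into `Setup.Y`), with exchangeable features and an eventually well-defined leverage. -/
structure ScaleFamilyModel : Prop where
  measurable_X : ∀ i, Measurable (S.X i)
  measurable_η : ∀ i, Measurable (S.η i)
  measurable_fit : ∀ n, Measurable (S.fit n)
  exchangeable_X : Exchangeable μ S.X
  indep_η : iIndepFun S.η μ
  ident_η : ∀ i, IdentDistrib (S.η i) (S.η 0) μ μ
  indep_X_η : IndepFun (fun ω i => S.X i ω) (fun ω i => S.η i ω) μ
  memLp_η : MemLp (S.η 0) 2 μ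
  mean_η : ∫ ω, S.η 0 ω ∂μ = 0
  var_η : variance (S.η 0) μ = 1
  σ_pos : 0 < S.σ
  g_cont : ContinuousOn S.g (Set.Ici 0)
  g_mono : StrictMonoOn S.g (Set.Ici 0)
  g_zero : 0 < S.g 0
  gram_invertible :
    Tendsto (fun n => μ {ω | ¬ IsUnit (gram (S.design n ω))}) atTop (𝓝 0)

/-- Regularity as `n₁, n₂ → ∞` with `p` fixed: root-`n₁` consistency, weak convergence (in
probability) of the empirical leverage distribution to `Fh`, continuity of the noise cdf. -/
structure Regular (Fh : Measure ℝ) : Prop where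
  n₁_tendsto : Tendsto S.n₁ atTop atTop
  n₂_tendsto : Tendsto S.n₂ atTop atTop
  consistent : IsBigOInProbability μ (fun n ω => ‖S.βhat n ω - S.βstar‖)
    (fun n => 1 / √(S.n₁ n))
  leverage_weak : ∀ φ : ℝ →ᵇ ℝ, TendstoInMeasure μ
    (fun n ω => (∑ i : Fin (S.n₂ n), φ (S.h n ω (S.X (S.n₁ n + i) ω))) / (S.n₂ n : ℝ))
    atTop (fun _ => ∫ t, φ t ∂Fh)
  cdf_cont : Continuous (cdf (μ.map (S.η 0)))

/-- What the comparison of expected widths needs in addition: `F_{|η|}⁻¹ (1 - α)` is well defined,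
the noise variance `σ² E[g (h (X_{n+1}))]` of the test point stays bounded, and the mean squared
estimation error `E[(X_{n+1}ᵀ (β̂ - β*))²]` at the test point vanishes. -/
structure WidthRegular (α : ℝ) : Prop where
  quantile_unique : ∃! q : ℝ, cdf (μ.map fun ω => |S.η 0 ω|) q = 1 - α
  noise_variance_bounded : ∃ B : ℝ, ∀ᶠ n in atTop,
    ∫⁻ ω, ENNReal.ofReal (S.g (S.htest n ω)) ∂μ ≤ ENNReal.ofReal B
  prediction_error : Tendsto
    (fun n => ∫⁻ ω, ENNReal.ofReal ((inner ℝ (S.Xtest n ω) (S.βhat n ω - S.βstar)) ^ 2) ∂μ)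
    atTop (𝓝 0)

end Setup

end LWCP

end

/-! With `p` fixed, leverage disappears in the limit. The leverages of a design with `m + 1` rows
sum to at most `p`, so by exchangeability a row has expected leverage at most `p / (m + 1)`. When
the training Gram matrix is invertible, a fresh point of leverage `t` has leverage `t / (1 + t)`
once added to the design. Hence fresh leverages tend to zero in probability (`uniformlySmall_h`),
the law `Fh` is the point mass at zero (`ae_eq_zero`), and the noise scale tends to `σ √(g 0)`.

The prediction error at a fresh point is a vanishing estimation error times a tight feature, so it
vanishes too. The scores are thus close to `σ |η|` for the weight `wstar` and to `σ √(g 0) |η|` for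
the constant weight. The law of large numbers for the noise, and Markov's inequality for the number
of badly approximated scores, trap the threshold between neighbouring quantiles
(`tendsto_threshold_lt`, `tendsto_lt_threshold`).

Coverage: the covered event differs by a set of vanishing probability from `|η| ≤ q` for the test
noise, `q` being a `(1 - α)`-quantile of `|η|` (`tendsto_symmDiff`). The latter event is independent
of the leverage, which yields the first two statements. For the third, leverage zero means `x = 0`
when the Gram matrix is invertible, and there the coverage is the noise distribution function at the
normalized threshold.

Width: both half-widths tend in probability to `σ √(g 0) q`. A threshold is at most a multiple of
the mean score, and second moments dominate the scores up to a small expectation, so the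
expectations converge as well (`tendsto_integral_of_dominated`). -/

noncomputable section

namespace LWCP

/-! ### Linear algebra and measurability of leverages. -/

section Leverage

variable {p m : ℕ}

lemma gram_apply (x : Fin m → EuclideanSpace ℝ (Fin p)) (a b : Fin p) :
    gram x a b = ∑ i, x i a * x i b := by
  simp [gram, Matrix.mul_apply]

lemma gram_posSemidef (x : Fin m → EuclideanSpace ℝ (Fin p)) : (gram x).PosSemidef := by
  have := Matrix.posSemidef_conjTranspose_mul_self (Matrix.of fun i j => x i j)
  simpa [gram, Matrix.conjTranspose_eq_transpose_of_trivial] using this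

lemma gram_posDef {x : Fin m → EuclideanSpace ℝ (Fin p)} (h : IsUnit (gram x)) :
    (gram x).PosDef :=
  (gram_posSemidef x).posDef_iff_isUnit.2 h

lemma leverage_nonneg (x : Fin m → EuclideanSpace ℝ (Fin p)) (z : EuclideanSpace ℝ (Fin p)) :
    0 ≤ leverage x z := by
  have := (gram_posSemidef x).inv.dotProduct_mulVec_nonneg z.ofLp
  simpa [leverage] using this

/-- The inverse of a positive definite matrix is positive definite. This leaves the origin as the
only test point in the exact-leverage coverage statement. -/
lemma eq_zero_of_leverage_eq_zero {x : Fin m → EuclideanSpace ℝ (Fin p)}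
    (h : IsUnit (gram x)) {z : EuclideanSpace ℝ (Fin p)} (hz : leverage x z = 0) : z = 0 := by
  by_contra hne
  have hne' : z.ofLp ≠ 0 := fun h0 => hne (by ext i; simp [h0])
  have := (gram_posDef h).inv.dotProduct_mulVec_pos hne'
  simp only [star_trivial] at this
  exact absurd hz this.ne'

/-- The sum is the trace of `G⁻¹ G` for the Gram matrix `G`: it equals `p` if `G` is invertible, and
`0` otherwise because the inverse of a singular matrix is by convention zero. -/
lemma sum_leverage_le (x : Fin m → EuclideanSpace ℝ (Fin p)) :
    ∑ j, leverage x (x j) ≤ p := by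
  have key : ∑ j, leverage x (x j) = ((gram x)⁻¹ * gram x).trace := by
    simp only [leverage, dotProduct, Matrix.mulVec, Matrix.trace, Matrix.diag, Matrix.mul_apply,
      gram_apply, Finset.mul_sum]
    rw [Finset.sum_comm]
    refine Finset.sum_congr rfl fun a _ => ?_
    rw [Finset.sum_comm]
    exact Finset.sum_congr rfl fun b _ => Finset.sum_congr rfl fun j _ => by ring
  rw [key]
  by_cases h : IsUnit (gram x)
  · rw [Matrix.nonsing_inv_mul _ ((Matrix.isUnit_iff_isUnit_det _).1 h)]
    simp
  · rw [Matrix.nonsing_inv_apply_not_isUnit _ (fun h' => h ((Matrix.isUnit_iff_isUnit_det _).2 h'))]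
    simp

lemma leverage_comp_perm (x : Fin m → EuclideanSpace ℝ (Fin p)) (τ : Equiv.Perm (Fin m))
    (z : EuclideanSpace ℝ (Fin p)) : leverage (fun i => x (τ i)) z = leverage x z := by
  have : gram (fun i => x (τ i)) = gram x := by
    ext a b
    rw [gram_apply, gram_apply]
    exact Equiv.sum_comp τ fun i => x i a * x i b
  rw [leverage, leverage, this]

/-- The leverage of a point in the design enlarged by that point. -/
lemma leverage_enlarged (x : Fin (m + 1) → EuclideanSpace ℝ (Fin p))
    (h : IsUnit (gram fun i : Fin m => x i.castSucc)) :
    leverage x (x (Fin.last m)) * (1 + leverage (fun i : Fin m => x i.castSucc) (x (Fin.last m)))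
      = leverage (fun i : Fin m => x i.castSucc) (x (Fin.last m)) := by
  set y := fun i : Fin m => x i.castSucc with hy
  set z := (x (Fin.last m)).ofLp with hz
  have hG : gram x = gram y + Matrix.vecMulVec z z := by
    ext a b
    simp [gram_apply, Fin.sum_univ_castSucc, hy, hz, Matrix.vecMulVec_apply]
  have hrank : (Matrix.vecMulVec z z).PosSemidef := by
    simpa using Matrix.posSemidef_vecMulVec_self_star z
  have hU : IsUnit (gram x) := by
    rw [hG]
    exact ((gram_posDef h).add_posSemidef hrank).isUnit
  have hUd := (Matrix.isUnit_iff_isUnit_det _).1 hU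
  have hyd := (Matrix.isUnit_iff_isUnit_det _).1 h
  -- Sherman–Morrison: appending `z` adds the rank-one matrix `z zᵀ` to the Gram matrix, and this
  -- maps `(gram y)⁻¹ z` to `leverage y z` times `z`.
  have hv : gram x *ᵥ ((gram y)⁻¹ *ᵥ z) = (1 + leverage y (x (Fin.last m))) • z := by
    rw [hG, Matrix.add_mulVec, Matrix.mulVec_mulVec, Matrix.mul_nonsing_inv _ hyd,
      Matrix.one_mulVec, Matrix.vecMulVec_mulVec, add_smul, one_smul]
    simp [leverage, hz]
  have hv' : (gram y)⁻¹ *ᵥ z = (1 + leverage y (x (Fin.last m))) • ((gram x)⁻¹ *ᵥ z) := by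
    rw [← Matrix.mulVec_smul, ← hv, Matrix.mulVec_mulVec, Matrix.nonsing_inv_mul _ hUd,
      Matrix.one_mulVec]
  conv_rhs => rw [leverage]
  rw [← hz, hv', dotProduct_smul, smul_eq_mul, mul_comm]
  rfl

/-- Determinant and adjugate are polynomial in the entries, so this form gives measurability across
singular Gram matrices, where inversion is not continuous. -/
lemma leverage_eq_det_mul (x : Fin m → EuclideanSpace ℝ (Fin p)) (z : EuclideanSpace ℝ (Fin p)) :
    leverage x z = (gram x).det⁻¹ * (z.ofLp ⬝ᵥ ((gram x).adjugate *ᵥ z.ofLp)) := by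
  rw [leverage, Matrix.inv_def, Matrix.smul_mulVec, dotProduct_smul, Ring.inverse_eq_inv',
    smul_eq_mul]

lemma continuous_gram : Continuous (gram : (Fin m → EuclideanSpace ℝ (Fin p)) → _) := by
  refine continuous_matrix fun a b => ?_
  simp only [gram_apply]
  fun_prop

lemma measurable_leverage :
    Measurable fun w : (Fin m → EuclideanSpace ℝ (Fin p)) × EuclideanSpace ℝ (Fin p) =>
      leverage w.1 w.2 := by
  simp only [leverage_eq_det_mul]
  have hg : Continuous fun w : (Fin m → EuclideanSpace ℝ (Fin p)) × EuclideanSpace ℝ (Fin p) =>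
      gram w.1 := continuous_gram.comp continuous_fst
  have hz : Continuous fun w : (Fin m → EuclideanSpace ℝ (Fin p)) × EuclideanSpace ℝ (Fin p) =>
      w.2.ofLp := by fun_prop
  refine (hg.matrix_det.measurable.inv).mul ?_
  exact (Continuous.dotProduct hz (hg.matrix_adjugate.matrix_mulVec hz)).measurable

end Leverage

/-! ### Order statistics. -/

section KthSmallest

variable {m k : ℕ} {s : Fin m → ℝ}

lemma kthSmallest_set_nonempty (hkm : k ≤ m) (s : Fin m → ℝ) :
    {t : ℝ | k ≤ (Finset.univ.filter fun i => s i ≤ t).card}.Nonempty := by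
  obtain ⟨t, ht⟩ := (Set.finite_range s).bddAbove
  refine ⟨t, ?_⟩
  rw [Set.mem_ofPred_eq, Finset.filter_true_of_mem fun i _ => ht ⟨i, rfl⟩]
  simpa using hkm

lemma kthSmallest_set_bddBelow (hk : 1 ≤ k) (s : Fin m → ℝ) :
    BddBelow {t : ℝ | k ≤ (Finset.univ.filter fun i => s i ≤ t).card} := by
  obtain ⟨b, hb⟩ := (Set.finite_range s).bddBelow
  refine ⟨b, fun t ht => ?_⟩
  obtain ⟨i, hi⟩ := Finset.card_pos.1 (lt_of_lt_of_le hk ht)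
  exact (hb ⟨i, rfl⟩).trans (Finset.mem_filter.1 hi).2

lemma kthSmallest_nonneg (hs : ∀ i, 0 ≤ s i) (hk : 1 ≤ k) : 0 ≤ kthSmallest k s := by
  refine Real.sInf_nonneg fun t ht => ?_
  obtain ⟨i, hi⟩ := Finset.card_pos.1 (lt_of_lt_of_le hk ht)
  exact (hs i).trans (Finset.mem_filter.1 hi).2

lemma kthSmallest_le (hk : 1 ≤ k) {t : ℝ}
    (ht : k ≤ (Finset.univ.filter fun i => s i ≤ t).card) : kthSmallest k s ≤ t :=
  csInf_le (kthSmallest_set_bddBelow hk s) ht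

/-- Rational `t` suffice because the count is monotone in `t`; a countable union then yields
measurability. -/
lemma kthSmallest_lt_iff (hk : 1 ≤ k) (hkm : k ≤ m) {a : ℝ} :
    kthSmallest k s < a ↔ ∃ t : ℚ, (t : ℝ) < a ∧ k ≤ (Finset.univ.filter fun i => s i ≤ t).card := by
  constructor
  · intro h
    obtain ⟨t, ht, hta⟩ := exists_lt_of_csInf_lt (kthSmallest_set_nonempty hkm s) h
    obtain ⟨r, hr, hra⟩ := exists_rat_btwn hta
    refine ⟨r, hra, le_trans ht (Finset.card_le_card fun i hi => ?_)⟩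
    simp only [Finset.mem_filter, Finset.mem_univ, true_and] at hi ⊢
    exact hi.trans hr.le
  · rintro ⟨t, hta, ht⟩
    exact (kthSmallest_le hk ht).trans_lt hta

lemma le_card_of_kthSmallest_lt (hk : 1 ≤ k) (hkm : k ≤ m) {a : ℝ} (h : kthSmallest k s < a) :
    k ≤ (Finset.univ.filter fun i => s i ≤ a).card := by
  obtain ⟨t, hta, ht⟩ := (kthSmallest_lt_iff hk hkm).1 h
  refine ht.trans (Finset.card_le_card fun i hi => ?_)
  simp only [Finset.mem_filter, Finset.mem_univ, true_and] at hi ⊢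
  exact hi.trans hta.le

lemma measurable_kthSmallest {Ω : Type*} [MeasurableSpace Ω] (hk : 1 ≤ k) (hkm : k ≤ m)
    {s : Fin m → Ω → ℝ} (hs : ∀ i, Measurable (s i)) :
    Measurable fun ω => kthSmallest k fun i => s i ω := by
  refine measurable_of_Iio fun a => ?_
  have : (fun ω => kthSmallest k fun i => s i ω) ⁻¹' Set.Iio a
      = ⋃ t : ℚ, {_ω | (t : ℝ) < a} ∩ {ω | k ≤ ∑ i, if s i ω ≤ t then 1 else 0} := by
    ext ω
    simp [kthSmallest_lt_iff hk hkm]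
  rw [this]
  refine MeasurableSet.iUnion fun t => MeasurableSet.inter (.const _) ?_
  refine measurableSet_le measurable_const (Finset.measurable_sum _ fun i _ => ?_)
  exact Measurable.ite (measurableSet_le (hs i) measurable_const) measurable_const measurable_const

/-- The `k`-th smallest of nonnegative values is at most a multiple of their mean, as soon as a
proportion `c` of the values lies above rank `k`. -/
lemma kthSmallest_le_sum (hs : ∀ i, 0 ≤ s i) (hk : 1 ≤ k) {c : ℝ} (hc : 0 < c) (hm : 0 < m)
    (hkm : (k : ℝ) ≤ m - c * m) : kthSmallest k s ≤ (∑ i, s i) / (c * m) := by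
  have hm' : (0 : ℝ) < m := by exact_mod_cast hm
  have hS : 0 ≤ ∑ i, s i := Finset.sum_nonneg fun i _ => hs i
  refine le_of_forall_gt_imp_ge_of_dense fun t ht => kthSmallest_le hk ?_
  have ht0 : 0 < t := lt_of_le_of_lt (by positivity) ht
  -- Markov's inequality for the counting measure: if more than `c * m` values exceeded `t`, their
  -- sum would be too large.
  have hsplit := Finset.card_filter_add_card_filter_not (s := (Finset.univ : Finset (Fin m)))
    (fun i => s i ≤ t)
  have hlarge : ((Finset.univ.filter fun i => ¬ s i ≤ t).card : ℝ) * t ≤ ∑ i, s i := by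
    calc ((Finset.univ.filter fun i => ¬ s i ≤ t).card : ℝ) * t
        = ∑ i ∈ Finset.univ.filter fun i => ¬ s i ≤ t, t := by simp
      _ ≤ ∑ i ∈ Finset.univ.filter fun i => ¬ s i ≤ t, s i :=
        Finset.sum_le_sum fun i hi => (not_le.1 (Finset.mem_filter.1 hi).2).le
      _ ≤ ∑ i, s i := Finset.sum_le_univ_sum_of_nonneg hs
  rw [div_lt_iff₀ (by positivity)] at ht
  have hcard : ((Finset.univ.filter fun i => ¬ s i ≤ t).card : ℝ) ≤ c * m := by
    by_contra hcon
    have := mul_lt_mul_of_pos_right (not_le.1 hcon) ht0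
    linarith
  have hsplit' : ((Finset.univ.filter fun i => s i ≤ t).card : ℝ)
      + (Finset.univ.filter fun i => ¬ s i ≤ t).card = m := by
    rw [← Nat.cast_add, hsplit]; simp
  have : (k : ℝ) ≤ (Finset.univ.filter fun i => s i ≤ t).card := by linarith
  exact_mod_cast this

end KthSmallest

/-! ### Convergence to zero in probability, uniformly over the points outside the training set. -/

section UniformlySmall

variable {Ω : Type*} [MeasurableSpace Ω] {μ : Measure Ω}

/-- `W n j` tends to zero in probability as `n → ∞`, uniformly in `j ≥ N n`. -/
def UniformlySmall (μ : Measure Ω) (N : ℕ → ℕ) (W : ℕ → ℕ → Ω → ℝ) : Prop :=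
  ∀ ε : ℝ, 0 < ε → ∀ δ : ℝ≥0∞, 0 < δ → ∀ᶠ n in atTop, ∀ j, N n ≤ j → μ {ω | ε ≤ |W n j ω|} ≤ δ

variable {N : ℕ → ℕ} {V W : ℕ → ℕ → Ω → ℝ}

lemma UniformlySmall.tendsto (h : UniformlySmall μ N W) {j : ℕ → ℕ} (hj : ∀ n, N n ≤ j n)
    {ε : ℝ} (hε : 0 < ε) : Tendsto (fun n => μ {ω | ε ≤ |W n (j n) ω|}) atTop (𝓝 0) := by
  rw [ENNReal.tendsto_nhds_zero]
  intro δ hδ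
  filter_upwards [h ε hε δ hδ] with n hn using hn _ (hj n)

/-- The calibration block moves and grows with `n`, so bounds must hold for all its points at once.
Points outside the training set are identically distributed, hence one point is enough. -/
lemma UniformlySmall.of_tendsto
    (h : ∀ ε : ℝ, 0 < ε → Tendsto (fun n => μ {ω | ε ≤ |W n (N n) ω|}) atTop (𝓝 0))
    (hW : ∀ n j, N n ≤ j → IdentDistrib (W n j) (W n (N n)) μ μ) : UniformlySmall μ N W := by
  intro ε hε δ hδ
  filter_upwards [ENNReal.tendsto_nhds_zero.1 (h ε hε) δ hδ] with n hn j hj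
  have hs : MeasurableSet {x : ℝ | ε ≤ |x|} := measurableSet_le measurable_const measurable_abs
  exact ((hW n j hj).measure_mem_eq hs).trans_le hn

lemma UniformlySmall.mono (hW : UniformlySmall μ N W)
    (h : ∀ n j ω, N n ≤ j → |V n j ω| ≤ |W n j ω|) : UniformlySmall μ N V := by
  intro ε hε δ hδ
  filter_upwards [hW ε hε δ hδ] with n hn j hj
  exact (measure_mono fun ω (hω : ε ≤ _) => hω.trans (h n j ω hj)).trans (hn j hj)

lemma UniformlySmall.add (hV : UniformlySmall μ N V) (hW : UniformlySmall μ N W) :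
    UniformlySmall μ N fun n j ω => V n j ω + W n j ω := by
  intro ε hε δ hδ
  filter_upwards [hV (ε / 2) (half_pos hε) (δ / 2) (ENNReal.half_pos hδ.ne'),
    hW (ε / 2) (half_pos hε) (δ / 2) (ENNReal.half_pos hδ.ne')] with n h₁ h₂ j hj
  calc μ {ω | ε ≤ |V n j ω + W n j ω|}
      ≤ μ ({ω | ε / 2 ≤ |V n j ω|} ∪ {ω | ε / 2 ≤ |W n j ω|}) := by
        refine measure_mono fun ω (hω : ε ≤ _) => ?_
        by_contra hcon
        simp only [Set.mem_union, Set.mem_ofPred_eq, not_or, not_le] at hcon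
        linarith [abs_add_le (V n j ω) (W n j ω)]
    _ ≤ δ / 2 + δ / 2 := (measure_union_le _ _).trans (add_le_add (h₁ j hj) (h₂ j hj))
    _ = δ := ENNReal.add_halves δ

/-- A vanishing factor times a tight one vanishes: off an event of small probability the second
factor is below a constant. -/
lemma UniformlySmall.mul_tight (hW : UniformlySmall μ N W) {T : ℕ → Ω → ℝ}
    (hT : ∀ δ : ℝ≥0∞, 0 < δ → ∃ K : ℝ, ∀ j, μ {ω | K ≤ |T j ω|} ≤ δ) :
    UniformlySmall μ N fun n j ω => W n j ω * T j ω := by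
  intro ε hε δ hδ
  obtain ⟨K, hK⟩ := hT (δ / 2) (ENNReal.half_pos hδ.ne')
  have hK' : 0 < max K 1 := lt_max_of_lt_right one_pos
  filter_upwards [hW (ε / max K 1) (by positivity) (δ / 2) (ENNReal.half_pos hδ.ne')]
    with n h₁ j hj
  calc μ {ω | ε ≤ |W n j ω * T j ω|}
      ≤ μ ({ω | ε / max K 1 ≤ |W n j ω|} ∪ {ω | K ≤ |T j ω|}) := by
        refine measure_mono fun ω (hω : ε ≤ _) => ?_
        by_contra hcon
        simp only [Set.mem_union, Set.mem_ofPred_eq, not_or, not_le] at hcon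
        rw [abs_mul] at hω
        have h1 : |W n j ω| * |T j ω| ≤ |W n j ω| * max K 1 :=
          mul_le_mul_of_nonneg_left (hcon.2.le.trans (le_max_left _ _)) (abs_nonneg _)
        have h2 := (lt_div_iff₀ hK').1 hcon.1
        linarith
    _ ≤ δ / 2 + δ / 2 := (measure_union_le _ _).trans (add_le_add (h₁ j hj) (hK j))
    _ = δ := ENNReal.add_halves δ

lemma exists_forall_measure_abs_ge_le [IsProbabilityMeasure μ] {T : ℕ → Ω → ℝ}
    (hT : ∀ j, IdentDistrib (T j) (T 0) μ μ) {δ : ℝ≥0∞} (hδ : 0 < δ) :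
    ∃ K : ℝ, ∀ j, μ {ω | K ≤ |T j ω|} ≤ δ := by
  have hs : ∀ K : ℝ, MeasurableSet {x : ℝ | K ≤ |x|} := fun K =>
    measurableSet_le measurable_const measurable_abs
  have : Tendsto (fun k : ℕ => (μ.map (T 0)) {x : ℝ | (k : ℝ) ≤ |x|}) atTop (𝓝 0) := by
    have hempty : ⋂ k : ℕ, {x : ℝ | (k : ℝ) ≤ |x|} = ∅ := by
      refine Set.eq_empty_of_forall_notMem fun x hx => ?_
      obtain ⟨k, hk⟩ := exists_nat_gt |x|
      exact absurd (Set.mem_iInter.1 hx k) (not_le.2 hk)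
    rw [← measure_empty (μ := μ.map (T 0)), ← hempty]
    refine tendsto_measure_iInter_atTop (fun k => (hs k).nullMeasurableSet) ?_
      ⟨0, measure_ne_top_of_subset (Set.subset_univ _) ?_⟩
    · intro k l hkl x (hx : (l : ℝ) ≤ |x|)
      exact le_trans (by exact_mod_cast hkl) hx
    · rw [Measure.map_apply_of_aemeasurable (hT 0).aemeasurable_snd .univ]
      exact measure_ne_top _ _
  obtain ⟨k, hk⟩ := ((ENNReal.tendsto_nhds_zero.1 this) δ hδ).exists
  refine ⟨k, fun j => ?_⟩
  have h1 := (hT j).measure_mem_eq (hs k)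
  rw [Measure.map_apply_of_aemeasurable (hT 0).aemeasurable_snd (hs k)] at hk
  exact h1.trans_le hk

end UniformlySmall

/-! ### Score approximation, exchangeability and vanishing leverages. -/

namespace Setup

variable {Ω : Type*} {p : ℕ} (S : Setup Ω p)

/-- The same setup on the space of sequences of features and noises. -/
def canonical : Setup ((ℕ → EuclideanSpace ℝ (Fin p)) × (ℕ → ℝ)) p where
  X i w := w.1 i
  η i w := w.2 i
  βstar := S.βstar
  σ := S.σ
  g := S.g
  n₁ := S.n₁
  n₂ := S.n₂
  fit := S.fit

/-- The sequences of features and noises, with the features reordered by `τ`. -/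
def path (τ : Equiv.Perm ℕ) (ω : Ω) : (ℕ → EuclideanSpace ℝ (Fin p)) × (ℕ → ℝ) :=
  (fun i => S.X (τ i) ω, fun i => S.η i ω)

lemma h_nonneg (n : ℕ) (ω : Ω) (z : EuclideanSpace ℝ (Fin p)) : 0 ≤ S.h n ω z :=
  leverage_nonneg _ _

lemma residual_eq (n j : ℕ) (ω : Ω) : S.Y n j ω - S.fhat n ω (S.X j ω)
    = S.σ * √(S.g (S.h n ω (S.X j ω))) * S.η j ω
      - inner ℝ (S.X j ω) (S.βhat n ω - S.βstar) := by
  simp only [Y, response, fhat, inner_sub_right]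
  ring

section Measurability

variable [MeasurableSpace Ω]

/-- All ingredients of the setup are measurable. -/
structure IsMeasurable : Prop where
  measurable_X : ∀ i, Measurable (S.X i)
  measurable_η : ∀ i, Measurable (S.η i)
  measurable_fit : ∀ n, Measurable (S.fit n)
  g_cont : ContinuousOn S.g (Set.Ici 0)

variable {S}

lemma ScaleFamilyModel.isMeasurable {μ : Measure Ω} (hS : S.ScaleFamilyModel μ) :
    S.IsMeasurable :=
  ⟨hS.measurable_X, hS.measurable_η, hS.measurable_fit, hS.g_cont⟩

lemma IsMeasurable.canonical (hS : S.IsMeasurable) : S.canonical.IsMeasurable :=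
  ⟨fun i => (measurable_pi_apply i).comp measurable_fst,
    fun i => (measurable_pi_apply i).comp measurable_snd, hS.measurable_fit, hS.g_cont⟩

namespace IsMeasurable

lemma design (hS : S.IsMeasurable) (n : ℕ) : Measurable (S.design n) :=
  measurable_pi_lambda _ fun i => hS.measurable_X i

lemma h (hS : S.IsMeasurable) (n j : ℕ) : Measurable fun ω => S.h n ω (S.X j ω) :=
  measurable_leverage.comp ((hS.design n).prodMk (hS.measurable_X j))

lemma g_h (hS : S.IsMeasurable) (n j : ℕ) : Measurable fun ω => S.g (S.h n ω (S.X j ω)) := by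
  -- `g` is controlled on `[0, ∞)` only; truncating its argument gives a function continuous on the
  -- whole line with the same values at leverages.
  have hg : Continuous fun t => S.g (max t 0) :=
    hS.g_cont.comp_continuous (by fun_prop) fun t => le_max_right t 0
  have : (fun ω => S.g (S.h n ω (S.X j ω)))
      = (fun t => S.g (max t 0)) ∘ fun ω => S.h n ω (S.X j ω) := by
    ext ω
    simp [max_eq_left (S.h_nonneg n ω (S.X j ω))]
  rw [this]
  exact hg.measurable.comp (hS.h n j)

lemma Y (hS : S.IsMeasurable) (n j : ℕ) : Measurable (S.Y n j) := by
  have h1 : Measurable fun ω => inner ℝ (S.X j ω) S.βstar :=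
    (hS.measurable_X j).inner measurable_const
  exact h1.add (((hS.g_h n j).sqrt.const_mul S.σ).mul (hS.measurable_η j))

lemma βhat (hS : S.IsMeasurable) (n : ℕ) : Measurable (S.βhat n) :=
  (hS.measurable_fit n).comp
    (measurable_pi_lambda _ fun i => (hS.measurable_X i).prodMk (hS.Y n i))

lemma error (hS : S.IsMeasurable) (n j : ℕ) :
    Measurable fun ω => inner ℝ (S.X j ω) (S.βhat n ω - S.βstar) :=
  (hS.measurable_X j).inner ((hS.βhat n).sub measurable_const)

end IsMeasurable

end Measurability

variable {S} [MeasurableSpace Ω] {μ : Measure Ω}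

lemma ScaleFamilyModel.g_zero_le (hS : S.ScaleFamilyModel μ) {t : ℝ} (ht : 0 ≤ t) : S.g 0 ≤ S.g t :=
  hS.g_mono.monotoneOn (Set.mem_Ici.2 le_rfl) ht ht

lemma ScaleFamilyModel.sqrt_g_pos (hS : S.ScaleFamilyModel μ) (n : ℕ) (ω : Ω)
    (z : EuclideanSpace ℝ (Fin p)) : 0 < √(S.g (S.h n ω z)) :=
  Real.sqrt_pos.2 (hS.g_zero.trans_le (hS.g_zero_le (S.h_nonneg n ω z)))

/-- The weight cancels the noise scale exactly, so only the prediction error remains, divided by a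
scale that is at least `√(g 0)`. -/
lemma ScaleFamilyModel.abs_score_wstar_sub_le (hS : S.ScaleFamilyModel μ) (n j : ℕ) (ω : Ω) :
    |S.score S.wstar n ω (S.X j ω) (S.Y n j ω) - (S.σ * |S.η j ω|)|
      ≤ |inner ℝ (S.X j ω) (S.βhat n ω - S.βstar)| / √(S.g 0) := by
  have hs := hS.sqrt_g_pos n ω (S.X j ω)
  have hs0 : 0 < √(S.g 0) := Real.sqrt_pos.2 hS.g_zero
  have hle : √(S.g 0) ≤ √(S.g (S.h n ω (S.X j ω))) :=
    Real.sqrt_le_sqrt (hS.g_zero_le (S.h_nonneg n ω (S.X j ω)))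
  rw [score, S.residual_eq, wstar]
  set s := √(S.g (S.h n ω (S.X j ω)))
  set e := inner ℝ (S.X j ω) (S.βhat n ω - S.βstar)
  have h1 : S.σ * |S.η j ω| = |S.σ * s * S.η j ω| * (1 / s) := by
    rw [abs_mul, abs_mul, abs_of_pos hS.σ_pos, abs_of_pos hs]
    field_simp
  rw [h1, ← sub_mul, abs_mul, abs_of_pos (by positivity : 0 < 1 / s), mul_one_div]
  have h2 : |(|S.σ * s * S.η j ω - e| - |S.σ * s * S.η j ω|)| ≤ |e| := by
    have := abs_abs_sub_abs_le (S.σ * s * S.η j ω - e) (S.σ * s * S.η j ω)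
    simpa using this
  exact div_le_div₀ (abs_nonneg _) h2 hs0 hle

lemma ScaleFamilyModel.abs_score_one_sub_le (hS : S.ScaleFamilyModel μ) (n j : ℕ) (ω : Ω) :
    |S.score (fun _ => 1) n ω (S.X j ω) (S.Y n j ω) - (S.σ * √(S.g 0) * |S.η j ω|)|
      ≤ |inner ℝ (S.X j ω) (S.βhat n ω - S.βstar)|
        + S.σ * |(√(S.g (S.h n ω (S.X j ω))) - √(S.g 0)) * S.η j ω| := by
  rw [score, S.residual_eq, mul_one]
  set s := √(S.g (S.h n ω (S.X j ω)))
  set e := inner ℝ (S.X j ω) (S.βhat n ω - S.βstar)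
  have h1 : S.σ * √(S.g 0) * |S.η j ω| = |S.σ * √(S.g 0) * S.η j ω| := by
    rw [abs_mul, abs_mul, abs_of_pos hS.σ_pos, abs_of_nonneg (Real.sqrt_nonneg _)]
  rw [h1]
  refine (abs_abs_sub_abs_le _ _).trans ?_
  have h2 : S.σ * s * S.η j ω - e - S.σ * √(S.g 0) * S.η j ω
      = S.σ * ((s - √(S.g 0)) * S.η j ω) - e := by ring
  rw [h2]
  refine (abs_sub _ _).trans ?_
  rw [abs_mul S.σ, abs_of_pos hS.σ_pos, add_comm]

lemma Regular.uniformlySmall_estimate {Fh : Measure ℝ} (hR : S.Regular μ Fh) :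
    UniformlySmall μ S.n₁ fun n _ ω => ‖S.βhat n ω - S.βstar‖ := by
  intro ε hε δ hδ
  obtain ⟨M, hM⟩ := hR.consistent δ hδ
  have hlim : Tendsto (fun n => M * (1 / √(S.n₁ n))) atTop (𝓝 0) := by
    have h1 : Tendsto (fun n => √(S.n₁ n)) atTop atTop :=
      Real.tendsto_sqrt_atTop.comp (tendsto_natCast_atTop_atTop.comp hR.n₁_tendsto)
    have := (h1.inv_tendsto_atTop).const_mul M
    simpa using this
  filter_upwards [hM, hlim.eventually (gt_mem_nhds hε)] with n h₁ h₂ j _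
  exact (measure_mono fun ω (hω : ε ≤ _) => lt_of_lt_of_le h₂ hω).trans h₁

variable [IsProbabilityMeasure μ]

/-- By independence the joint law is a product, and reordering the features preserves its first
factor. Evaluating the `canonical` setup along `path` transports this invariance to every measurable
functional of the data. -/
lemma ScaleFamilyModel.identDistrib_path (hS : S.ScaleFamilyModel μ) (τ : Equiv.Perm ℕ) :
    IdentDistrib (S.path τ) (S.path 1) μ μ := by
  have hη : Measurable fun ω i => S.η i ω := measurable_pi_lambda _ hS.measurable_η
  have hX : ∀ τ : Equiv.Perm ℕ, Measurable fun ω i => S.X (τ i) ω := fun τ =>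
    measurable_pi_lambda _ fun i => hS.measurable_X (τ i)
  have hlaw : ∀ τ : Equiv.Perm ℕ, μ.map (S.path τ)
      = (μ.map fun ω i => S.X i ω).prod (μ.map fun ω i => S.η i ω) := by
    intro τ
    have hind : IndepFun (fun ω i => S.X (τ i) ω) (fun ω i => S.η i ω) μ := by
      have hm : Measurable fun (x : ℕ → EuclideanSpace ℝ (Fin p)) i => x (τ i) :=
        measurable_pi_lambda _ fun i => measurable_pi_apply (τ i)
      exact hS.indep_X_η.comp hm measurable_id
    rw [← hS.exchangeable_X τ]
    exact (indepFun_iff_map_prod_eq_prod_map_map (hX τ).aemeasurable hη.aemeasurable).1 hind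
  exact ⟨((hX τ).prodMk hη).aemeasurable, ((hX 1).prodMk hη).aemeasurable,
    (hlaw τ).trans (hlaw 1).symm⟩

/-- The joint law of the estimate, of a point outside the training set and of its leverage does
not depend on the point. -/
lemma ScaleFamilyModel.identDistrib_point (hS : S.ScaleFamilyModel μ) (n : ℕ) {j k : ℕ}
    (hj : S.n₁ n ≤ j) (hk : S.n₁ n ≤ k) :
    IdentDistrib (fun ω => (S.X j ω, S.βhat n ω, S.h n ω (S.X j ω)))
      (fun ω => (S.X k ω, S.βhat n ω, S.h n ω (S.X k ω))) μ μ := by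
  -- Both indices lie outside the training set, so the swap fixes the training features and hence
  -- the estimate.
  have hτ : ∀ i : Fin (S.n₁ n), Equiv.swap j k (i : ℕ) = i := fun i =>
    Equiv.swap_apply_of_ne_of_ne (by have := i.2; omega) (by have := i.2; omega)
  have hC := hS.isMeasurable.canonical
  have hmeas : Measurable fun w => (S.canonical.X k w, S.canonical.βhat n w,
      S.canonical.h n w (S.canonical.X k w)) :=
    (hC.measurable_X k).prodMk ((hC.βhat n).prodMk (hC.h n k))
  have := (hS.identDistrib_path (Equiv.swap j k)).comp hmeas
  have hdesign : ∀ ω, S.canonical.design n (S.path (Equiv.swap j k) ω) = S.design n ω := by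
    intro ω
    funext i
    exact congrArg (fun a => S.X a ω) (hτ i)
  have hβ : ∀ ω, S.canonical.βhat n (S.path (Equiv.swap j k) ω) = S.βhat n ω := by
    intro ω
    refine congrArg (S.fit n) (funext fun i => ?_)
    have hXi : S.canonical.X i (S.path (Equiv.swap j k) ω) = S.X i ω :=
      congrArg (fun a => S.X a ω) (hτ i)
    have hYi : S.canonical.Y n i (S.path (Equiv.swap j k) ω) = S.Y n i ω := by
      simp only [Y, response, h, hXi, hdesign]
      rfl
    rw [hXi, hYi]
  convert! this using 1
  · funext ω
    have hXk : S.canonical.X k (S.path (Equiv.swap j k) ω) = S.X j ω :=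
      congrArg (fun a => S.X a ω) (Equiv.swap_apply_right j k)
    simp only [Function.comp_apply, hXk, hβ, h, hdesign]
    rfl

lemma ScaleFamilyModel.identDistrib_h (hS : S.ScaleFamilyModel μ) (n : ℕ) {j k : ℕ}
    (hj : S.n₁ n ≤ j) (hk : S.n₁ n ≤ k) :
    IdentDistrib (fun ω => S.h n ω (S.X j ω)) (fun ω => S.h n ω (S.X k ω)) μ μ :=
  (hS.identDistrib_point n hj hk).comp (measurable_snd.comp measurable_snd)

lemma ScaleFamilyModel.identDistrib_error (hS : S.ScaleFamilyModel μ) (n : ℕ) {j k : ℕ}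
    (hj : S.n₁ n ≤ j) (hk : S.n₁ n ≤ k) :
    IdentDistrib (fun ω => inner ℝ (S.X j ω) (S.βhat n ω - S.βstar))
      (fun ω => inner ℝ (S.X k ω) (S.βhat n ω - S.βstar)) μ μ := by
  have hu : Measurable fun w : EuclideanSpace ℝ (Fin p) × EuclideanSpace ℝ (Fin p) × ℝ =>
      inner ℝ w.1 (w.2.1 - S.βstar) :=
    measurable_fst.inner ((measurable_fst.comp measurable_snd).sub measurable_const)
  exact (hS.identDistrib_point n hj hk).comp hu

lemma ScaleFamilyModel.identDistrib_X (hS : S.ScaleFamilyModel μ) (j : ℕ) :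
    IdentDistrib (S.X j) (S.X 0) μ μ := by
  have hm := hS.isMeasurable.canonical.measurable_X 0
  have := (hS.identDistrib_path (Equiv.swap j 0)).comp hm
  convert! this using 1
  funext ω
  exact (congrArg (fun a => S.X a ω) (Equiv.swap_apply_right j 0)).symm

/-- The expected leverage of a point in a design with `m + 1` points is at most `p / (m + 1)`. -/
lemma ScaleFamilyModel.lintegral_leverage_le (hS : S.ScaleFamilyModel μ) (m : ℕ) :
    ((m : ℝ≥0∞) + 1) * ∫⁻ ω, ENNReal.ofReal
      (leverage (fun i : Fin (m + 1) => S.X i ω) (S.X m ω)) ∂μ ≤ p := by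
  have hmeas : ∀ j : ℕ, Measurable fun w : (ℕ → EuclideanSpace ℝ (Fin p)) × (ℕ → ℝ) =>
      ENNReal.ofReal (leverage (fun i : Fin (m + 1) => w.1 i) (w.1 j)) := by
    intro j
    refine (measurable_leverage.comp (Measurable.prodMk ?_ ?_)).ennreal_ofReal
    · exact measurable_pi_lambda _ fun i => (measurable_pi_apply _).comp measurable_fst
    · exact (measurable_pi_apply _).comp measurable_fst
  have hsame : ∀ j : Fin (m + 1),
      ∫⁻ ω, ENNReal.ofReal (leverage (fun i : Fin (m + 1) => S.X i ω) (S.X j ω)) ∂μ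
      = ∫⁻ ω, ENNReal.ofReal (leverage (fun i : Fin (m + 1) => S.X i ω) (S.X m ω)) ∂μ := by
    intro j
    have hid := ((hS.identDistrib_path (Equiv.swap (j : ℕ) m)).comp (hmeas m)).lintegral_eq
    refine Eq.trans (lintegral_congr fun ω => ?_) hid
    -- The swap of `j` and `m` merely permutes the rows of the enlarged design, which leaves its
    -- Gram matrix unchanged.
    have hswap : ∀ i : Fin (m + 1),
        Equiv.swap (j : ℕ) m i = (Equiv.swap j (Fin.last m) i : Fin (m + 1)) := by
      intro i
      simp only [Equiv.swap_apply_def, Fin.ext_iff, Fin.val_last]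
      split_ifs <;> simp
    simp only [Function.comp_apply, path, Equiv.swap_apply_right, hswap]
    rw [leverage_comp_perm (fun i : Fin (m + 1) => S.X i ω) (Equiv.swap j (Fin.last m))]
  calc ((m : ℝ≥0∞) + 1) * ∫⁻ ω, ENNReal.ofReal
        (leverage (fun i : Fin (m + 1) => S.X i ω) (S.X m ω)) ∂μ
      = ∑ j : Fin (m + 1), ∫⁻ ω, ENNReal.ofReal
        (leverage (fun i : Fin (m + 1) => S.X i ω) (S.X j ω)) ∂μ := by
        simp [hsame]
    _ = ∫⁻ ω, ∑ j : Fin (m + 1), ENNReal.ofReal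
        (leverage (fun i : Fin (m + 1) => S.X i ω) (S.X j ω)) ∂μ := by
        refine (lintegral_finsetSum _ fun j _ => ?_).symm
        refine (measurable_leverage.comp (Measurable.prodMk ?_ ?_)).ennreal_ofReal
        · exact measurable_pi_lambda _ fun i => hS.measurable_X i
        · exact hS.measurable_X j
    _ ≤ ∫⁻ _, (p : ℝ≥0∞) ∂μ := by
        refine lintegral_mono fun ω => ?_
        rw [← ENNReal.ofReal_sum_of_nonneg fun j _ => leverage_nonneg _ _]
        refine (ENNReal.ofReal_le_ofReal
          (sum_leverage_le fun i : Fin (m + 1) => S.X i ω)).trans ?_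
        simp
    _ = p := by simp

/-- The leverages of the points outside the training set tend to zero in probability. -/
lemma ScaleFamilyModel.uniformlySmall_h (hS : S.ScaleFamilyModel μ)
    (hn : Tendsto S.n₁ atTop atTop) :
    UniformlySmall μ S.n₁ fun n j ω => S.h n ω (S.X j ω) := by
  refine .of_tendsto (fun ε hε => ?_) fun n j hj => hS.identDistrib_h n hj le_rfl
  -- The map `t ↦ t / (1 + t)` is increasing, so leverage at least `ε` forces leverage at least `ε /
  -- (1 + ε)` in the enlarged design, to which Markov's inequality applies.
  set ε' : ℝ≥0∞ := ENNReal.ofReal (ε / (1 + ε)) with hε'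
  have hε'0 : ε' ≠ 0 := by
    simp only [hε', ne_eq, ENNReal.ofReal_eq_zero, not_le]
    positivity
  have hbound : ∀ n, μ {ω | ε ≤ |S.h n ω (S.X (S.n₁ n) ω)|}
      ≤ μ {ω | ¬ IsUnit (gram (S.design n ω))} + (p / ε') / ((S.n₁ n : ℝ≥0∞) + 1) := by
    intro n
    set L : Ω → ℝ≥0∞ := fun ω => ENNReal.ofReal
      (leverage (fun i : Fin (S.n₁ n + 1) => S.X i ω) (S.X (S.n₁ n) ω)) with hL
    have hmarkov : μ {ω | ε' ≤ L ω} ≤ (p / ε') / ((S.n₁ n : ℝ≥0∞) + 1) := by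
      have hLm : AEMeasurable L μ := by
        refine (measurable_leverage.comp
          (Measurable.prodMk ?_ ?_)).ennreal_ofReal.aemeasurable
        · exact measurable_pi_lambda _ fun i => hS.measurable_X i
        · exact hS.measurable_X _
      have h1 := mul_meas_ge_le_lintegral₀ hLm ε'
      have h2 := hS.lintegral_leverage_le (S.n₁ n)
      rw [ENNReal.le_div_iff_mul_le (.inl (by simp)) (.inl (by simp)),
        ENNReal.le_div_iff_mul_le (.inl hε'0) (.inl ENNReal.ofReal_ne_top)]
      calc μ {ω | ε' ≤ L ω} * ((S.n₁ n : ℝ≥0∞) + 1) * ε'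
          = ((S.n₁ n : ℝ≥0∞) + 1) * (ε' * μ {ω | ε' ≤ L ω}) := by ring
        _ ≤ ((S.n₁ n : ℝ≥0∞) + 1) * ∫⁻ ω, L ω ∂μ := by gcongr
        _ ≤ p := h2
    refine le_trans (measure_mono (t := {ω | ¬ IsUnit (gram (S.design n ω))} ∪ {ω | ε' ≤ L ω}) ?_)
      ((measure_union_le _ _).trans (by gcongr))
    intro ω (hω : ε ≤ |S.h n ω (S.X (S.n₁ n) ω)|)
    rw [abs_of_nonneg (S.h_nonneg _ _ _)] at hω
    by_cases hU : IsUnit (gram (S.design n ω))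
    · right
      have := leverage_enlarged (fun i : Fin (S.n₁ n + 1) => S.X i ω) hU
      have hcast : leverage (fun i : Fin (S.n₁ n) => S.X (i.castSucc : Fin (S.n₁ n + 1)) ω)
        (S.X (Fin.last (S.n₁ n) : Fin (S.n₁ n + 1)) ω) = S.h n ω (S.X (S.n₁ n) ω) := rfl
      rw [hcast] at this
      refine ENNReal.ofReal_le_ofReal ?_
      have hlast : ((Fin.last (S.n₁ n) : Fin (S.n₁ n + 1)) : ℕ) = S.n₁ n := rfl
      rw [hlast] at this
      set l := leverage (fun i : Fin (S.n₁ n + 1) => S.X i ω) (S.X (S.n₁ n) ω)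
      set t := S.h n ω (S.X (S.n₁ n) ω)
      have ht : 0 < 1 + t := by linarith
      have hl : l = t / (1 + t) := by rw [eq_div_iff ht.ne', this]
      rw [hl, div_le_div_iff₀ (by linarith) ht]
      nlinarith
    · left
      exact hU
  refine tendsto_of_tendsto_of_tendsto_of_le_of_le tendsto_const_nhds ?_ (fun n => zero_le)
    hbound
  rw [show (0 : ℝ≥0∞) = 0 + 0 by simp]
  refine hS.gram_invertible.add ?_
  have hcast : Tendsto (fun n => (S.n₁ n : ℝ≥0∞) + 1) atTop (𝓝 ⊤) := by
    have := (ENNReal.tendsto_nat_nhds_top.comp hn).add (tendsto_const_nhds (x := (1 : ℝ≥0∞)))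
    simpa using this
  have := ENNReal.Tendsto.const_div (a := p / ε') hcast
    (.inr (ENNReal.div_ne_top (by simp) hε'0))
  simpa using this

/-! ### Limits of prediction errors, noise scales and scores. -/

section Regular

variable {Fh : Measure ℝ}

/-- The prediction errors outside the training set tend to zero in probability. -/
lemma ScaleFamilyModel.uniformlySmall_error (hS : S.ScaleFamilyModel μ)
    (hR : S.Regular μ Fh) :
    UniformlySmall μ S.n₁ fun n j ω => inner ℝ (S.X j ω) (S.βhat n ω - S.βstar) := by
  have htight : ∀ δ : ℝ≥0∞, 0 < δ → ∃ K : ℝ, ∀ j, μ {ω | K ≤ |‖S.X j ω‖|} ≤ δ := fun δ hδ =>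
    exists_forall_measure_abs_ge_le (T := fun j ω => ‖S.X j ω‖)
      (fun j => (hS.identDistrib_X j).comp measurable_norm) hδ
  refine (hR.uniformlySmall_estimate.mul_tight htight).mono fun n j ω _ => ?_
  rw [abs_mul, abs_norm, abs_norm, mul_comm]
  exact abs_real_inner_le_norm _ _

/-- The noise scales outside the training set converge in probability to the scale at zero. -/
lemma ScaleFamilyModel.uniformlySmall_scale (hS : S.ScaleFamilyModel μ)
    (hR : S.Regular μ Fh) :
    UniformlySmall μ S.n₁ fun n j ω => √(S.g (S.h n ω (S.X j ω))) - √(S.g 0) := by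
  intro ε hε δ hδ
  have hc : ContinuousWithinAt (fun t => √(S.g t)) (Set.Ici 0) 0 :=
    (hS.g_cont 0 (Set.mem_Ici.2 le_rfl)).sqrt
  obtain ⟨r, hr, hrε⟩ := Metric.continuousWithinAt_iff.1 hc ε hε
  filter_upwards [hS.uniformlySmall_h hR.n₁_tendsto r hr δ hδ] with n hn j hj
  refine (measure_mono fun ω (hω : ε ≤ _) => ?_).trans (hn j hj)
  by_contra hcon
  have hlt : |S.h n ω (S.X j ω)| < r := not_le.1 hcon
  have := hrε (S.h_nonneg n ω (S.X j ω)) (by simpa [Real.dist_eq] using hlt)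
  rw [Real.dist_eq] at this
  linarith

lemma ScaleFamilyModel.uniformlySmall_score_wstar (hS : S.ScaleFamilyModel μ)
    (hR : S.Regular μ Fh) : UniformlySmall μ S.n₁ fun n j ω =>
      S.score S.wstar n ω (S.X j ω) (S.Y n j ω) - S.σ * |S.η j ω| := by
  have htight : ∀ δ : ℝ≥0∞, 0 < δ → ∃ K : ℝ, ∀ j : ℕ, μ {_ω : Ω | K ≤ |1 / √(S.g 0)|} ≤ δ :=
    fun δ hδ => exists_forall_measure_abs_ge_le (T := fun _ _ => 1 / √(S.g 0))
      (fun _ => .refl aemeasurable_const) hδ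
  refine ((hS.uniformlySmall_error hR).mul_tight htight).mono fun n j ω _ => ?_
  refine (hS.abs_score_wstar_sub_le n j ω).trans (le_of_eq ?_)
  rw [abs_mul, abs_of_nonneg (by positivity : 0 ≤ 1 / √(S.g 0)), mul_one_div]

lemma ScaleFamilyModel.uniformlySmall_score_one (hS : S.ScaleFamilyModel μ)
    (hR : S.Regular μ Fh) : UniformlySmall μ S.n₁ fun n j ω =>
      S.score (fun _ => 1) n ω (S.X j ω) (S.Y n j ω) - S.σ * √(S.g 0) * |S.η j ω| := by
  have htight : ∀ δ : ℝ≥0∞, 0 < δ → ∃ K : ℝ, ∀ j : ℕ, μ {ω | K ≤ |S.σ * S.η j ω|} ≤ δ :=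
    fun δ hδ => exists_forall_measure_abs_ge_le (T := fun j ω => S.σ * S.η j ω)
      (fun j => (hS.ident_η j).comp (measurable_const_mul S.σ)) hδ
  have h1 : UniformlySmall μ S.n₁ fun n j ω =>
      |inner ℝ (S.X j ω) (S.βhat n ω - S.βstar)| :=
    (hS.uniformlySmall_error hR).mono fun n j ω _ => (abs_abs _).le
  have h2 : UniformlySmall μ S.n₁ fun n j ω =>
      S.σ * |(√(S.g (S.h n ω (S.X j ω))) - √(S.g 0)) * S.η j ω| := by
    refine ((hS.uniformlySmall_scale hR).mul_tight htight).mono fun n j ω _ => le_of_eq ?_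
    simp only [abs_mul, abs_abs]
    ring
  refine (h1.add h2).mono fun n j ω _ => (hS.abs_score_one_sub_le n j ω).trans (le_abs_self _)

end Regular

end Setup

/-! ### Asymptotics of the threshold's rank. -/

section Rank

/-- The rank of the calibration score that serves as a threshold. -/
def rank (α : ℝ) (m : ℕ) : ℕ := ⌈(1 - α) * ((m : ℝ) + 1)⌉₊

variable {α : ℝ}

lemma one_le_rank (hα : α < 1) (m : ℕ) : 1 ≤ rank α m :=
  Nat.ceil_pos.2 (mul_pos (by linarith) (by positivity))

lemma mul_le_rank (hα : α < 1) (m : ℕ) : (1 - α) * m ≤ rank α m := by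
  have : (1 - α) * ((m : ℝ) + 1) ≤ rank α m := Nat.le_ceil _
  linarith

lemma eventually_rank_le (hα : α ∈ Set.Ioo (0 : ℝ) 1) {κ : ℝ} (hκ : 0 < κ) :
    ∀ᶠ m : ℕ in atTop, (rank α m : ℝ) ≤ (1 - α + κ) * m := by
  have h : Tendsto (fun m : ℕ => κ * (m : ℝ)) atTop atTop :=
    tendsto_natCast_atTop_atTop.const_mul_atTop hκ
  -- The shift `m + 1` and the rounding cost at most `2 - α`, which is below `2`.
  filter_upwards [h.eventually_ge_atTop 2] with m hm
  have hc : (rank α m : ℝ) < (1 - α) * ((m : ℝ) + 1) + 1 :=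
    Nat.ceil_lt_add_one (mul_nonneg (by linarith [hα.2]) (by positivity))
  nlinarith [hα.1]

/-- A rank above `m` would make the infimum in `kthSmallest` run over the empty set and return the
default `0`; this excludes that case for large `m`. -/
lemma eventually_rank_le_self (hα : α ∈ Set.Ioo (0 : ℝ) 1) :
    ∀ᶠ m : ℕ in atTop, rank α m ≤ m := by
  filter_upwards [eventually_rank_le hα hα.1] with m hm
  have : (rank α m : ℝ) ≤ m := by linarith
  exact_mod_cast this

end Rank

/-! ### Empirical frequencies of events. -/

section EmpiricalFraction

variable {Ω : Type*} [MeasurableSpace Ω] {μ : Measure Ω}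

/-- Weak law of large numbers for the fraction of independent events, of equal probability, that
occur. -/
lemma measure_le_abs_card_sub_le [IsProbabilityMeasure μ] {m : ℕ} {E : Fin m → Set Ω} [∀ ω i, Decidable (ω ∈ E i)]
    (hE : ∀ i, MeasurableSet (E i))
    (hind : iIndepSet E μ) {q : ℝ} (hq : ∀ i, μ.real (E i) = q) {ε : ℝ} (hε : 0 < ε)
    (hm : 0 < m) :
    μ {ω | ε * m ≤ |((Finset.univ.filter fun i => ω ∈ E i).card : ℝ) - q * m|}
      ≤ ENNReal.ofReal (1 / ε ^ 2 / m) := by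
  set Z : Fin m → Ω → ℝ := fun i => (E i).indicator 1 with hZ
  have hm' : (0 : ℝ) < m := by exact_mod_cast hm
  have hZm : ∀ i, Measurable (Z i) := fun i => measurable_one.indicator (hE i)
  have hZb : ∀ i ω, Z i ω ∈ Set.Icc (0 : ℝ) 1 := fun i ω =>
    ⟨Set.indicator_nonneg (fun _ _ => zero_le_one) ω, Set.indicator_le_self' (by simp) ω⟩
  have hL : ∀ i, MemLp (Z i) 2 μ := fun i =>
    memLp_of_bounded (.of_forall (hZb i)) (hZm i).aestronglyMeasurable 2
  have hindep : iIndepFun Z μ := hind.iIndepFun_indicator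
  have hvar : variance (∑ i, Z i) μ ≤ m := by
    rw [IndepFun.variance_sum (fun i _ => hL i) fun i _ j _ hij => hindep.indepFun hij]
    calc ∑ i, variance (Z i) μ ≤ ∑ _i : Fin m, (1 : ℝ) := by
          refine Finset.sum_le_sum fun i _ => ?_
          refine (variance_le_sq_of_bounded (.of_forall (hZb i)) (hZm i).aemeasurable).trans ?_
          norm_num
      _ = m := by simp
  have hmean : μ[∑ i, Z i] = q * m := by
    simp only [Finset.sum_apply]
    rw [integral_finsetSum _ fun i _ => (hL i).integrable (by norm_num)]
    simp [hZ, integral_indicator_one, hE, hq, mul_comm]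
  have hsum : ∀ ω, (∑ i, Z i) ω = ((Finset.univ.filter fun i => ω ∈ E i).card : ℝ) := by
    intro ω
    simp [hZ, Set.indicator_apply]
  have hcheb := meas_ge_le_variance_div_sq (memLp_finsetSum' _ fun i _ => hL i)
    (mul_pos hε hm') (μ := μ) (X := ∑ i, Z i)
  rw [hmean] at hcheb
  simp only [hsum] at hcheb
  refine hcheb.trans (ENNReal.ofReal_le_ofReal ?_)
  calc variance (∑ i, Z i) μ / (ε * m) ^ 2 ≤ m / (ε * m) ^ 2 := by gcongr
    _ = 1 / ε ^ 2 / m := by field_simp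

/-- Markov's inequality for the number of events that occur. -/
lemma measure_le_card_le {m : ℕ} {E : Fin m → Set Ω} [∀ ω i, Decidable (ω ∈ E i)]
    (hE : ∀ i, MeasurableSet (E i)) {δ : ℝ≥0∞} (hδ : ∀ i, μ (E i) ≤ δ) {κ : ℝ} (hκ : 0 < κ)
    (hm : 0 < m) :
    μ {ω | κ * m ≤ ((Finset.univ.filter fun i => ω ∈ E i).card : ℝ)} ≤ δ / ENNReal.ofReal κ := by
  set f : Ω → ℝ≥0∞ := fun ω => ∑ i, (E i).indicator 1 ω with hf
  have hfm : Measurable f := Finset.measurable_sum _ fun i _ => measurable_one.indicator (hE i)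
  have hcard : ∀ ω, f ω = ((Finset.univ.filter fun i => ω ∈ E i).card : ℝ≥0∞) := by
    intro ω
    simp [hf, Set.indicator_apply]
  have hset : {ω | κ * m ≤ ((Finset.univ.filter fun i => ω ∈ E i).card : ℝ)}
      ⊆ {ω | ENNReal.ofReal κ * m ≤ f ω} := by
    intro ω (hω : κ * m ≤ _)
    have := ENNReal.ofReal_le_ofReal hω
    rw [ENNReal.ofReal_mul hκ.le, ENNReal.ofReal_natCast, ENNReal.ofReal_natCast] at this
    rwa [← hcard] at this
  have hκ0 : ENNReal.ofReal κ ≠ 0 := by simpa using hκ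
  have hm0 : (m : ℝ≥0∞) ≠ 0 := by simpa using hm.ne'
  have hint : ∫⁻ ω, f ω ∂μ ≤ m * δ := by
    simp only [hf]
    rw [lintegral_finsetSum _ fun i _ => measurable_one.indicator (hE i)]
    calc ∑ i, ∫⁻ ω, (E i).indicator 1 ω ∂μ ≤ ∑ _i : Fin m, δ := by
          refine Finset.sum_le_sum fun i _ => ?_
          rw [lintegral_indicator_one (hE i)]
          exact hδ i
      _ = m * δ := by simp
  have hmarkov := mul_meas_ge_le_lintegral hfm (ENNReal.ofReal κ * m) (μ := μ)
  refine (measure_mono hset).trans ?_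
  rw [ENNReal.le_div_iff_mul_le (.inl hκ0) (.inl ENNReal.ofReal_ne_top)]
  rw [← ENNReal.mul_le_mul_iff_right hm0 (ENNReal.natCast_ne_top m)]
  calc (m : ℝ≥0∞) * (μ {ω | ENNReal.ofReal κ * m ≤ f ω} * ENNReal.ofReal κ)
      = ENNReal.ofReal κ * m * μ {ω | ENNReal.ofReal κ * m ≤ f ω} := by ring
    _ ≤ m * δ := hmarkov.trans hint

end EmpiricalFraction

/-! ### The noise distribution function and the limits of thresholds. -/

namespace Setup

variable {Ω : Type*} {p : ℕ} {S : Setup Ω p} [MeasurableSpace Ω] {μ : Measure Ω}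

/-- The distribution function of the absolute value of the noise. -/
def noiseCDF (S : Setup Ω p) (μ : Measure Ω) : ℝ → ℝ := cdf (μ.map fun ω => |S.η 0 ω|)

lemma monotone_noiseCDF : Monotone (S.noiseCDF μ) := monotone_cdf _

/-- The deviations may depend on each other through the shared estimate, so only their expected
number is used. The level `δ * κ` for a single deviation offsets the factor `1 / κ` in Markov's
inequality. -/
lemma tendsto_bad_fraction {s : ℕ → ℕ → Ω → ℝ} (hn₂ : Tendsto S.n₂ atTop atTop) (hs : ∀ n j, Measurable (s n j))
    (hs0 : UniformlySmall μ S.n₁ s) {ε κ : ℝ} (hε : 0 < ε) (hκ : 0 < κ) :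
    Tendsto (fun n => μ {ω | κ * S.n₂ n ≤ ((Finset.univ.filter fun i : Fin (S.n₂ n) =>
      ε ≤ |s n (S.n₁ n + i) ω|).card : ℝ)}) atTop (𝓝 0) := by
  rw [ENNReal.tendsto_nhds_zero]
  intro δ hδ
  have hκ0 : ENNReal.ofReal κ ≠ 0 := by simpa using hκ
  filter_upwards [hn₂.eventually_gt_atTop 0,
    hs0 ε hε (δ * ENNReal.ofReal κ) (ENNReal.mul_pos hδ.ne' hκ0)] with n hn h
  have := measure_le_card_le (μ := μ) (E := fun i : Fin (S.n₂ n) => {ω | ε ≤ |s n (S.n₁ n + i) ω|})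
    (fun i => measurableSet_le measurable_const (hs _ _).abs) (fun i => h _ (Nat.le_add_right _ _))
    hκ hn
  rwa [ENNReal.mul_div_cancel_right hκ0 ENNReal.ofReal_ne_top] at this

variable [IsProbabilityMeasure μ]

lemma ScaleFamilyModel.noiseCDF_eq (hS : S.ScaleFamilyModel μ) (j : ℕ) (t : ℝ) :
    S.noiseCDF μ t = μ.real {ω | |S.η j ω| ≤ t} := by
  have hm : Measurable fun ω => |S.η 0 ω| := (hS.measurable_η 0).abs
  have := Measure.isProbabilityMeasure_map (μ := μ) hm.aemeasurable
  rw [noiseCDF, cdf_eq_real, map_measureReal_apply hm measurableSet_Iic]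
  have hs : MeasurableSet {x : ℝ | |x| ≤ t} := measurableSet_le measurable_abs measurable_const
  exact congrArg ENNReal.toReal ((hS.ident_η j).measure_mem_eq hs).symm

/-- A continuous distribution function has no atoms, so the closed interval `[-t, t]` has mass `F t
- F (-t)`. With `max t 0` one continuous formula also covers negative `t`. -/
lemma ScaleFamilyModel.noiseCDF_eq_cdf (hS : S.ScaleFamilyModel μ)
    (hc : Continuous (cdf (μ.map (S.η 0)))) (t : ℝ) :
    S.noiseCDF μ t = cdf (μ.map (S.η 0)) (max t 0) - cdf (μ.map (S.η 0)) (-max t 0) := by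
  have hm := hS.measurable_η 0
  have := Measure.isProbabilityMeasure_map (μ := μ) hm.aemeasurable
  set ν := μ.map (S.η 0)
  have hatom : ∀ a, ν {a} = 0 := by
    intro a
    rw [← measure_cdf ν, StieltjesFunction.measure_singleton,
      hc.continuousAt.continuousWithinAt.leftLim_eq]
    simp
  have hIcc : ∀ u, 0 ≤ u → ν.real (Set.Icc (-u) u) = cdf ν u - cdf ν (-u) := by
    intro u hu
    rw [measureReal_def]
    conv_lhs => rw [← measure_cdf ν]
    rw [StieltjesFunction.measure_Icc, hc.continuousAt.continuousWithinAt.leftLim_eq,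
      ENNReal.toReal_ofReal (sub_nonneg.2 (monotone_cdf ν (by linarith)))]
  rw [hS.noiseCDF_eq 0]
  rcases le_total 0 t with ht | ht
  · rw [max_eq_left ht, ← hIcc t ht, map_measureReal_apply hm measurableSet_Icc]
    congr 1
    ext ω
    simp [abs_le]
  · rw [max_eq_right ht, neg_zero, sub_self]
    have hsub : {ω | |S.η 0 ω| ≤ t} ⊆ S.η 0 ⁻¹' {0} := by
      intro ω (hω : |S.η 0 ω| ≤ t)
      exact abs_eq_zero.1 (le_antisymm (hω.trans ht) (abs_nonneg _))
    have h0 : μ (S.η 0 ⁻¹' {0}) = 0 := by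
      rw [← Measure.map_apply hm (measurableSet_singleton 0)]
      exact hatom 0
    rw [measureReal_def, measure_mono_null hsub h0, ENNReal.toReal_zero]

lemma ScaleFamilyModel.continuous_noiseCDF (hS : S.ScaleFamilyModel μ)
    (hc : Continuous (cdf (μ.map (S.η 0)))) : Continuous (S.noiseCDF μ) := by
  rw [funext (hS.noiseCDF_eq_cdf hc)]
  fun_prop

lemma ScaleFamilyModel.noiseCDF_of_nonpos (hS : S.ScaleFamilyModel μ)
    (hc : Continuous (cdf (μ.map (S.η 0)))) {t : ℝ} (ht : t ≤ 0) : S.noiseCDF μ t = 0 := by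
  rw [hS.noiseCDF_eq_cdf hc, max_eq_right ht, neg_zero, sub_self]

lemma ScaleFamilyModel.exists_noiseCDF_eq (hS : S.ScaleFamilyModel μ)
    (hc : Continuous (cdf (μ.map (S.η 0)))) {u : ℝ} (hu : u ∈ Set.Ioo (0 : ℝ) 1) :
    ∃ t, S.noiseCDF μ t = u := by
  obtain ⟨b, hb⟩ := ((tendsto_cdf_atTop (μ.map fun ω => |S.η 0 ω|)).eventually
    (lt_mem_nhds hu.2)).exists
  refine mem_range_of_exists_le_of_exists_ge (hS.continuous_noiseCDF hc) ⟨0, ?_⟩ ⟨b, hb.le⟩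
  rw [hS.noiseCDF_of_nonpos hc le_rfl]
  exact hu.1.le

/-- The threshold computed from the calibration scores `s n j`. -/
def threshold (S : Setup Ω p) (s : ℕ → ℕ → Ω → ℝ) (α : ℝ) (n : ℕ) (ω : Ω) : ℝ :=
  kthSmallest (rank α (S.n₂ n)) fun i : Fin (S.n₂ n) => s n (S.n₁ n + i) ω

section Threshold

variable {s : ℕ → ℕ → Ω → ℝ} {c : ℝ}

lemma ScaleFamilyModel.tendsto_noise_fraction (hS : S.ScaleFamilyModel μ)
    (hn₂ : Tendsto S.n₂ atTop atTop) (t : ℝ) {κ : ℝ} (hκ : 0 < κ) :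
    Tendsto (fun n => μ {ω | κ * S.n₂ n ≤ |((Finset.univ.filter fun i : Fin (S.n₂ n) =>
      |S.η (S.n₁ n + i) ω| ≤ t).card : ℝ) - S.noiseCDF μ t * S.n₂ n|}) atTop (𝓝 0) := by
  have hb : Tendsto (fun n => ENNReal.ofReal (1 / κ ^ 2 / (S.n₂ n : ℝ))) atTop (𝓝 0) := by
    rw [← ENNReal.ofReal_zero]
    refine (ENNReal.continuous_ofReal.tendsto 0).comp ?_
    exact tendsto_const_nhds.div_atTop (tendsto_natCast_atTop_atTop.comp hn₂)
  refine tendsto_of_tendsto_of_tendsto_of_le_of_le' tendsto_const_nhds hb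
    (.of_forall fun n => zero_le) ?_
  filter_upwards [hn₂.eventually_gt_atTop 0] with n hn
  classical
  have hT : MeasurableSet {x : ℝ | |x| ≤ t} := measurableSet_le measurable_abs measurable_const
  have hind : iIndepSet (fun i : Fin (S.n₂ n) => S.η (S.n₁ n + i) ⁻¹' {x : ℝ | |x| ≤ t}) μ := by
    have hinj : Function.Injective fun i : Fin (S.n₂ n) => S.n₁ n + (i : ℕ) := fun i j hij =>
      Fin.ext (by simpa using hij)
    have h1 : iIndepFun (fun i : Fin (S.n₂ n) => S.η (S.n₁ n + i)) μ := hS.indep_η.precomp hinj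
    rw [iIndepSet_iff_meas_biInter fun i => hS.measurable_η _ hT]
    intro F
    exact h1.measure_inter_preimage_eq_mul F fun i _ => hT
  exact measure_le_abs_card_sub_le (fun i => hS.measurable_η _ hT) hind
    (fun i => (hS.noiseCDF_eq _ t).symm) hκ hn

/-- If the threshold is below `c * a`, a fraction `1 - α` of the scores is at most `c * a`. Each of
these has noise at most `b` or deviates by at least `c * (b - a)`, and these two kinds make up too
small a fraction with high probability. -/
lemma ScaleFamilyModel.tendsto_threshold_lt (hS : S.ScaleFamilyModel μ)
    (hη : Continuous (cdf (μ.map (S.η 0)))) (hn₂ : Tendsto S.n₂ atTop atTop)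
    (hs : ∀ n j, Measurable (s n j)) (hc : 0 < c)
    (hclose : UniformlySmall μ S.n₁ fun n j ω => s n j ω - c * |S.η j ω|)
    {α : ℝ} (hα : α ∈ Set.Ioo (0 : ℝ) 1) {a : ℝ} (ha : S.noiseCDF μ a < 1 - α) :
    Tendsto (fun n => μ {ω | S.threshold s α n ω < c * a}) atTop (𝓝 0) := by
  obtain ⟨b, hFb, hab⟩ : ∃ b, S.noiseCDF μ b < 1 - α ∧ a < b :=
    ((((hS.continuous_noiseCDF hη).tendsto a).eventually (gt_mem_nhds ha)).filter_mono
      nhdsWithin_le_nhds |>.and (self_mem_nhdsWithin (s := Set.Ioi a))).exists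
  -- Half of the gap pays for the fluctuation of the noise frequency, half for the badly
  -- approximated scores.
  set κ := (1 - α - S.noiseCDF μ b) / 2 with hκ
  have hκ0 : 0 < κ := by rw [hκ]; linarith
  have hε : 0 < c * (b - a) := mul_pos hc (by linarith)
  have h1 := hS.tendsto_noise_fraction hn₂ b hκ0
  have h2 := tendsto_bad_fraction (μ := μ)
    (s := fun n j ω => s n j ω - c * |S.η j ω|) hn₂
    (fun n j => (hs n j).sub ((hS.measurable_η j).abs.const_mul c)) hclose hε hκ0
  have h12 := h1.add h2
  rw [add_zero] at h12
  refine tendsto_of_tendsto_of_tendsto_of_le_of_le' tendsto_const_nhds h12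
    (.of_forall fun n => zero_le) ?_
  filter_upwards [hn₂.eventually_gt_atTop 0, hn₂.eventually (eventually_rank_le_self hα)]
    with n hn hrank
  refine (measure_mono ?_).trans (measure_union_le _ _)
  intro ω (hω : S.threshold s α n ω < c * a)
  by_contra hcon
  simp only [Set.mem_union, Set.mem_ofPred_eq, not_or, not_le] at hcon
  have hcard := le_card_of_kthSmallest_lt (one_le_rank hα.2 _) hrank hω
  have hsub : (Finset.univ.filter fun i : Fin (S.n₂ n) => s n (S.n₁ n + i) ω ≤ c * a)
      ⊆ (Finset.univ.filter fun i : Fin (S.n₂ n) => |S.η (S.n₁ n + i) ω| ≤ b) ∪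
        (Finset.univ.filter fun i : Fin (S.n₂ n) =>
          c * (b - a) ≤ |s n (S.n₁ n + i) ω - (c * |S.η (S.n₁ n + i) ω|)|) := by
    intro i hi
    simp only [Finset.mem_union, Finset.mem_filter, Finset.mem_univ, true_and] at hi ⊢
    by_contra hi'
    rw [not_or, not_le, not_le] at hi'
    have h3 := (abs_lt.1 hi'.2).1
    have h4 := mul_lt_mul_of_pos_left hi'.1 hc
    linarith
  have h5 := hcard.trans ((Finset.card_le_card hsub).trans (Finset.card_union_le _ _))
  have h6 : (rank α (S.n₂ n) : ℝ)
      ≤ ((Finset.univ.filter fun i : Fin (S.n₂ n) => |S.η (S.n₁ n + i) ω| ≤ b).card : ℝ)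
        + ((Finset.univ.filter fun i : Fin (S.n₂ n) =>
          c * (b - a) ≤ |s n (S.n₁ n + i) ω - (c * |S.η (S.n₁ n + i) ω|)|).card : ℝ) := by
    exact_mod_cast h5
  have h7 := mul_le_rank hα.2 (S.n₂ n)
  have h8 := (abs_lt.1 hcon.1).2
  have h9 : (1 - α) * (S.n₂ n : ℝ) = S.noiseCDF μ b * S.n₂ n + κ * S.n₂ n + κ * S.n₂ n := by
    rw [hκ]; ring
  linarith [hcon.2]

lemma ScaleFamilyModel.tendsto_lt_threshold (hS : S.ScaleFamilyModel μ)
    (hη : Continuous (cdf (μ.map (S.η 0)))) (hn₂ : Tendsto S.n₂ atTop atTop)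
    (hs : ∀ n j, Measurable (s n j)) (hc : 0 < c)
    (hclose : UniformlySmall μ S.n₁ fun n j ω => s n j ω - c * |S.η j ω|)
    {α : ℝ} (hα : α ∈ Set.Ioo (0 : ℝ) 1) {b : ℝ} (hb : 1 - α < S.noiseCDF μ b) :
    Tendsto (fun n => μ {ω | c * b < S.threshold s α n ω}) atTop (𝓝 0) := by
  obtain ⟨a, hFa, hab⟩ : ∃ a, 1 - α < S.noiseCDF μ a ∧ a < b :=
    ((((hS.continuous_noiseCDF hη).tendsto b).eventually (lt_mem_nhds hb)).filter_mono
      nhdsWithin_le_nhds |>.and (self_mem_nhdsWithin (s := Set.Iio b))).exists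
  -- Here the gap is shared in three: the rank may also exceed `(1 - α) * n₂`.
  set κ := (S.noiseCDF μ a - (1 - α)) / 3 with hκ
  have hκ0 : 0 < κ := by rw [hκ]; linarith
  have hε : 0 < c * (b - a) := mul_pos hc (by linarith)
  have h1 := hS.tendsto_noise_fraction hn₂ a hκ0
  have h2 := tendsto_bad_fraction (μ := μ)
    (s := fun n j ω => s n j ω - c * |S.η j ω|) hn₂
    (fun n j => (hs n j).sub ((hS.measurable_η j).abs.const_mul c)) hclose hε hκ0
  have h12 := h1.add h2
  rw [add_zero] at h12
  refine tendsto_of_tendsto_of_tendsto_of_le_of_le' tendsto_const_nhds h12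
    (.of_forall fun n => zero_le) ?_
  filter_upwards [hn₂.eventually_gt_atTop 0, hn₂.eventually (eventually_rank_le hα hκ0)]
    with n hn hrank
  refine (measure_mono ?_).trans (measure_union_le _ _)
  intro ω (hω : c * b < S.threshold s α n ω)
  by_contra hcon
  simp only [Set.mem_union, Set.mem_ofPred_eq, not_or, not_le] at hcon
  have hcard : (Finset.univ.filter fun i : Fin (S.n₂ n) => s n (S.n₁ n + i) ω ≤ c * b).card
      < rank α (S.n₂ n) := by
    by_contra hle
    exact absurd hω (not_lt.2 (kthSmallest_le (one_le_rank hα.2 _) (not_lt.1 hle)))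
  have hsub : (Finset.univ.filter fun i : Fin (S.n₂ n) => |S.η (S.n₁ n + i) ω| ≤ a)
      ⊆ (Finset.univ.filter fun i : Fin (S.n₂ n) => s n (S.n₁ n + i) ω ≤ c * b) ∪
        (Finset.univ.filter fun i : Fin (S.n₂ n) =>
          c * (b - a) ≤ |s n (S.n₁ n + i) ω - (c * |S.η (S.n₁ n + i) ω|)|) := by
    intro i hi
    simp only [Finset.mem_union, Finset.mem_filter, Finset.mem_univ, true_and] at hi ⊢
    by_contra hi'
    rw [not_or, not_le, not_le] at hi'
    have h3 := (abs_lt.1 hi'.2).2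
    have h4 := mul_le_mul_of_nonneg_left hi hc.le
    linarith
  have h5 := (Finset.card_le_card hsub).trans (Finset.card_union_le _ _)
  have h6 : ((Finset.univ.filter fun i : Fin (S.n₂ n) => |S.η (S.n₁ n + i) ω| ≤ a).card : ℝ)
      ≤ ((Finset.univ.filter fun i : Fin (S.n₂ n) => s n (S.n₁ n + i) ω ≤ c * b).card : ℝ)
        + ((Finset.univ.filter fun i : Fin (S.n₂ n) =>
          c * (b - a) ≤ |s n (S.n₁ n + i) ω - (c * |S.η (S.n₁ n + i) ω|)|).card : ℝ) := by
    exact_mod_cast h5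
  have h7 : ((Finset.univ.filter fun i : Fin (S.n₂ n) => s n (S.n₁ n + i) ω ≤ c * b).card : ℝ)
      < rank α (S.n₂ n) := by exact_mod_cast hcard
  have h8 := (abs_lt.1 hcon.1).1
  have h9 : S.noiseCDF μ a * (S.n₂ n : ℝ)
      = (1 - α + κ) * S.n₂ n + κ * S.n₂ n + κ * S.n₂ n := by
    rw [hκ]; ring
  linarith [hcon.2]

/-- The noise distribution function at the normalized threshold tends to `1 - α` in
probability. -/
lemma ScaleFamilyModel.tendsto_noiseCDF_threshold (hS : S.ScaleFamilyModel μ)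
    (hη : Continuous (cdf (μ.map (S.η 0)))) (hn₂ : Tendsto S.n₂ atTop atTop)
    (hs : ∀ n j, Measurable (s n j)) (hc : 0 < c)
    (hclose : UniformlySmall μ S.n₁ fun n j ω => s n j ω - c * |S.η j ω|)
    {α : ℝ} (hα : α ∈ Set.Ioo (0 : ℝ) 1) {ε : ℝ} (hε : 0 < ε) :
    Tendsto (fun n => μ {ω | ε ≤ |S.noiseCDF μ (S.threshold s α n ω / c) - (1 - α)|})
      atTop (𝓝 0) := by
  -- Small enough to beat `ε` and to keep both levels `1 - α ± d` inside `(0, 1)`. Levels are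
  -- trapped rather than thresholds, since the quantile need not be unique.
  set d := min ε (min α (1 - α)) / 2 with hd
  have hα0 : 0 < α := hα.1
  have hα1 : 0 < 1 - α := by linarith [hα.2]
  have hd0 : 0 < d := by positivity
  have hdε : d < ε := by have := min_le_left ε (min α (1 - α)); linarith
  have hdm : 2 * d ≤ min α (1 - α) := by have := min_le_right ε (min α (1 - α)); linarith
  have hdα : d < α := by linarith [min_le_left α (1 - α)]
  have hdα' : d < 1 - α := by linarith [min_le_right α (1 - α)]
  obtain ⟨a, ha⟩ := hS.exists_noiseCDF_eq hη (u := 1 - α - d) ⟨by linarith, by linarith⟩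
  obtain ⟨b, hb⟩ := hS.exists_noiseCDF_eq hη (u := 1 - α + d) ⟨by linarith, by linarith⟩
  have h := (hS.tendsto_threshold_lt hη hn₂ hs hc hclose hα (a := a) (by linarith)).add
    (hS.tendsto_lt_threshold hη hn₂ hs hc hclose hα (b := b) (by linarith))
  rw [add_zero] at h
  refine tendsto_of_tendsto_of_tendsto_of_le_of_le tendsto_const_nhds h
    (fun n => zero_le) fun n => (measure_mono ?_).trans (measure_union_le _ _)
  intro ω (hω : ε ≤ |_|)
  by_contra hcon
  simp only [Set.mem_union, Set.mem_ofPred_eq, not_or, not_lt] at hcon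
  have h1 := monotone_noiseCDF (S := S) (μ := μ) ((le_div_iff₀' hc).2 hcon.1)
  have h2 := monotone_noiseCDF (S := S) (μ := μ) ((div_le_iff₀' hc).2 hcon.2)
  rw [ha] at h1
  rw [hb] at h2
  have : |S.noiseCDF μ (S.threshold s α n ω / c) - (1 - α)| ≤ d :=
    abs_le.2 ⟨by linarith, by linarith⟩
  linarith

/-- If the quantile is unique, then the threshold converges in probability. -/
lemma ScaleFamilyModel.tendsto_threshold (hS : S.ScaleFamilyModel μ)
    (hη : Continuous (cdf (μ.map (S.η 0)))) (hn₂ : Tendsto S.n₂ atTop atTop)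
    (hs : ∀ n j, Measurable (s n j)) (hc : 0 < c)
    (hclose : UniformlySmall μ S.n₁ fun n j ω => s n j ω - c * |S.η j ω|)
    {α : ℝ} (hα : α ∈ Set.Ioo (0 : ℝ) 1) {q : ℝ} (hq : S.noiseCDF μ q = 1 - α)
    (hq' : ∀ t, S.noiseCDF μ t = 1 - α → t = q) {ε : ℝ} (hε : 0 < ε) :
    Tendsto (fun n => μ {ω | ε ≤ |S.threshold s α n ω - c * q|}) atTop (𝓝 0) := by
  have hd : 0 < ε / (2 * c) := by positivity
  -- Uniqueness makes the monotone distribution function differ from `1 - α` on either side of `q`.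
  have ha : S.noiseCDF μ (q - ε / (2 * c)) < 1 - α := by
    refine lt_of_le_of_ne (hq ▸ monotone_noiseCDF (by linarith)) fun h => ?_
    linarith [hq' _ h]
  have hb : 1 - α < S.noiseCDF μ (q + ε / (2 * c)) := by
    refine lt_of_le_of_ne (hq ▸ monotone_noiseCDF (by linarith)) fun h => ?_
    linarith [hq' _ h.symm]
  have h := (hS.tendsto_threshold_lt hη hn₂ hs hc hclose hα ha).add
    (hS.tendsto_lt_threshold hη hn₂ hs hc hclose hα hb)
  rw [add_zero] at h
  refine tendsto_of_tendsto_of_tendsto_of_le_of_le tendsto_const_nhds h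
    (fun n => zero_le) fun n => (measure_mono ?_).trans (measure_union_le _ _)
  intro ω (hω : ε ≤ |_|)
  by_contra hcon
  simp only [Set.mem_union, Set.mem_ofPred_eq, not_or, not_lt, mul_sub, mul_add] at hcon
  have h1 : c * (ε / (2 * c)) = ε / 2 := by field_simp
  rw [h1] at hcon
  have : |S.threshold s α n ω - c * q| ≤ ε / 2 := abs_le.2 ⟨by linarith, by linarith⟩
  linarith

end Threshold

end Setup

/-- The conditional probability of an event is close to the probability of an independent event
that almost coincides with it. -/
lemma integral_abs_condExp_sub_le {Ω : Type*} {m m' m₀ : MeasurableSpace Ω} {μ : Measure[m₀] Ω}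
    [IsProbabilityMeasure μ] (hm : m ≤ m₀) (hm' : m' ≤ m₀) {A B : Set Ω}
    (hA : MeasurableSet[m₀] A) (hB : MeasurableSet[m'] B) (hind : Indep m' m μ) :
    ∫ ω, |(μ⟦A | m⟧) ω - μ.real B| ∂μ ≤ μ.real (symmDiff A B) := by
  have hB₀ : MeasurableSet[m₀] B := hm' B hB
  have hiA : Integrable (A.indicator fun _ => (1 : ℝ)) μ := (integrable_const 1).indicator hA
  have hiB : Integrable (B.indicator fun _ => (1 : ℝ)) μ := (integrable_const 1).indicator hB₀
  -- Independence makes the conditional probability of `B` constant; the rest is the `L¹`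
  -- contraction of conditional expectation.
  have hcondB : μ⟦B | m⟧ =ᵐ[μ] fun _ => μ.real B := by
    have := condExp_indep_eq hm' hm ((stronglyMeasurable_const (b := (1 : ℝ))).indicator hB) hind
    have hval : ∫ ω, B.indicator (fun _ => (1 : ℝ)) ω ∂μ = μ.real B := by
      rw [integral_indicator hB₀, setIntegral_const, smul_eq_mul, mul_one]
    rw [hval] at this
    exact this
  have hdiff : (fun ω => |(μ⟦A | m⟧) ω - μ.real B|) =ᵐ[μ]
      fun ω => |(μ[A.indicator (fun _ => (1 : ℝ)) - B.indicator (fun _ => (1 : ℝ)) | m]) ω| := by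
    filter_upwards [hcondB, condExp_sub hiA hiB m] with ω h1 h2
    rw [h2, Pi.sub_apply, h1]
  rw [integral_congr_ae hdiff]
  refine (integral_abs_condExp_le _).trans (le_of_eq ?_)
  have habs : ∀ ω, |(A.indicator (fun _ => (1 : ℝ)) - B.indicator (fun _ => (1 : ℝ))) ω|
      = (symmDiff A B).indicator (fun _ => (1 : ℝ)) ω := by
    intro ω
    by_cases hA : ω ∈ A <;> by_cases hB : ω ∈ B <;> simp [Set.indicator, Set.mem_symmDiff, hA, hB]
  simp only [habs]
  rw [integral_indicator (hA.symmDiff hB₀), setIntegral_const, smul_eq_mul, mul_one]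

/-! ### Conditional coverage. -/

namespace Setup

variable {Ω : Type*} {p : ℕ} {S : Setup Ω p} [MeasurableSpace Ω] {μ : Measure Ω}
  {Fh : Measure ℝ} {α : ℝ}

lemma IsMeasurable.score_wstar (hS : S.IsMeasurable) (n j : ℕ) :
    Measurable fun ω => S.score S.wstar n ω (S.X j ω) (S.Y n j ω) :=
  (((hS.Y n j).sub ((hS.measurable_X j).inner (hS.βhat n))).abs).mul
    (measurable_const.div (hS.g_h n j).sqrt)

lemma IsMeasurable.score_one (hS : S.IsMeasurable) (n j : ℕ) :
    Measurable fun ω => S.score (fun _ => 1) n ω (S.X j ω) (S.Y n j ω) :=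
  (((hS.Y n j).sub ((hS.measurable_X j).inner (hS.βhat n))).abs).mul measurable_const

lemma eventually_measurable_threshold (hn₂ : Tendsto S.n₂ atTop atTop)
    (hα : α ∈ Set.Ioo (0 : ℝ) 1) {s : ℕ → ℕ → Ω → ℝ} (hs : ∀ n j, Measurable (s n j)) :
    ∀ᶠ n in atTop, Measurable (S.threshold s α n) := by
  filter_upwards [hn₂.eventually (eventually_rank_le_self hα)] with n hn
  exact measurable_kthSmallest (one_le_rank hα.2 _) hn fun i => hs n (S.n₁ n + i)

lemma ScaleFamilyModel.covered_eq (hS : S.ScaleFamilyModel μ) (n : ℕ) :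
    S.covered S.wstar α n = {ω | S.score S.wstar n ω (S.Xtest n ω) (S.Ytest n ω)
      ≤ S.qhat S.wstar α n ω} := by
  ext ω
  have hw : 0 < S.wstar (S.h n ω (S.Xtest n ω)) := one_div_pos.2 (hS.sqrt_g_pos n ω _)
  simp only [covered, interval, score, Set.mem_ofPred_eq, Set.mem_Icc]
  rw [← le_div_iff₀ hw, abs_le]
  constructor <;> rintro ⟨h1, h2⟩ <;> constructor <;> linarith

lemma ScaleFamilyModel.eventually_measurableSet_covered (hS : S.ScaleFamilyModel μ)
    (hR : S.Regular μ Fh) (hα : α ∈ Set.Ioo (0 : ℝ) 1) :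
    ∀ᶠ n in atTop, MeasurableSet (S.covered S.wstar α n) := by
  filter_upwards [eventually_measurable_threshold (S := S) hR.n₂_tendsto hα
    fun n j => hS.isMeasurable.score_wstar n j] with n hn
  rw [hS.covered_eq]
  exact measurableSet_le (hS.isMeasurable.score_wstar n _) hn

/-- The noise of the test point is at most `q` in absolute value. -/
def smallNoise (S : Setup Ω p) (q : ℝ) (n : ℕ) : Set Ω := {ω | |S.η (S.testIdx n) ω| ≤ q}

lemma ScaleFamilyModel.measurable_htest (hS : S.ScaleFamilyModel μ) (n : ℕ) :
    Measurable (S.htest n) := hS.isMeasurable.h n _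

lemma ScaleFamilyModel.measurableSet_smallNoise (hS : S.ScaleFamilyModel μ) (q : ℝ) (n : ℕ) :
    MeasurableSet (S.smallNoise q n) :=
  measurableSet_le (hS.measurable_η _).abs measurable_const

/-- Leverages are independent of the noise. -/
lemma ScaleFamilyModel.indepFun_η_h (hS : S.ScaleFamilyModel μ) (n i j : ℕ) :
    IndepFun (S.η i) (fun ω => S.h n ω (S.X j ω)) μ := by
  have hm : Measurable fun x : ℕ → EuclideanSpace ℝ (Fin p) =>
      leverage (fun k : Fin (S.n₁ n) => x k) (x j) :=
    measurable_leverage.comp (Measurable.prodMk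
      (measurable_pi_lambda _ fun k : Fin (S.n₁ n) => measurable_pi_apply (k : ℕ))
      (measurable_pi_apply j))
  exact (hS.indep_X_η.comp hm (measurable_pi_apply i)).symm

variable [IsProbabilityMeasure μ]

/-- The event of coverage is asymptotically equal to the event that the noise of the test point
is below its quantile. -/
lemma ScaleFamilyModel.tendsto_symmDiff (hS : S.ScaleFamilyModel μ) (hR : S.Regular μ Fh)
    (hα : α ∈ Set.Ioo (0 : ℝ) 1) {q : ℝ} (hq : S.noiseCDF μ q = 1 - α) :
    Tendsto (fun n => μ (symmDiff (S.covered S.wstar α n) (S.smallNoise q n))) atTop (𝓝 0) := by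
  rw [ENNReal.tendsto_nhds_zero]
  intro δ hδ
  obtain ⟨r, hr0, hrδ⟩ := ENNReal.lt_iff_exists_nnreal_btwn.1 hδ
  have hr0' : (0 : ℝ) < r := by exact_mod_cast hr0
  have hα0 : 0 < α := hα.1
  have hα1 : 0 < 1 - α := by linarith [hα.2]
  set d := min (r : ℝ) (min α (1 - α)) / 8 with hd
  have hd0 : 0 < d := by positivity
  have hdr : 8 * d ≤ r := by have := min_le_left (r : ℝ) (min α (1 - α)); linarith
  have hdm : 8 * d ≤ min α (1 - α) := by have := min_le_right (r : ℝ) (min α (1 - α)); linarith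
  have hdα : 8 * d ≤ α := hdm.trans (min_le_left _ _)
  have hdα' : 8 * d ≤ 1 - α := hdm.trans (min_le_right _ _)
  have hη := hR.cdf_cont
  -- With high probability the threshold lies in `[σ a₁, σ b₁]` and the test score is within `σ (a₁
  -- - a₂)` and `σ (b₂ - b₁)` of `σ |η|`. The two events can then differ only if `a₂ < |η| ≤ b₂`.
  -- This slab may be wide if the quantile is not unique, but its probability is `4 * d ≤ r / 2`.
  obtain ⟨a₁, ha₁⟩ := hS.exists_noiseCDF_eq hη (u := 1 - α - d) ⟨by linarith, by linarith⟩
  obtain ⟨a₂, ha₂⟩ := hS.exists_noiseCDF_eq hη (u := 1 - α - 2 * d) ⟨by linarith, by linarith⟩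
  obtain ⟨b₁, hb₁⟩ := hS.exists_noiseCDF_eq hη (u := 1 - α + d) ⟨by linarith, by linarith⟩
  obtain ⟨b₂, hb₂⟩ := hS.exists_noiseCDF_eq hη (u := 1 - α + 2 * d) ⟨by linarith, by linarith⟩
  have hmono := monotone_noiseCDF (S := S) (μ := μ)
  have ha : a₂ < a₁ := hmono.reflect_lt (by rw [ha₁, ha₂]; linarith)
  have hb : b₁ < b₂ := hmono.reflect_lt (by rw [hb₁, hb₂]; linarith)
  have haq : a₂ < q := hmono.reflect_lt (by rw [hq, ha₂]; linarith)
  have hqb : q < b₂ := hmono.reflect_lt (by rw [hq, hb₂]; linarith)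
  have hs := fun n j => hS.isMeasurable.score_wstar n j
  have hclose := hS.uniformlySmall_score_wstar hR
  have hσ := hS.σ_pos
  have hlim := ((hS.tendsto_threshold_lt hη hR.n₂_tendsto hs hσ hclose hα (a := a₁)
    (by linarith)).add (hS.tendsto_lt_threshold hη hR.n₂_tendsto hs hσ hclose hα (b := b₁)
    (by linarith))).add ((hclose.tendsto (j := S.testIdx) (fun n => Nat.le_add_right _ _)
    (mul_pos hσ (sub_pos.2 ha))).add (hclose.tendsto (j := S.testIdx)
    (fun n => Nat.le_add_right _ _) (mul_pos hσ (sub_pos.2 hb))))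
  simp only [add_zero] at hlim
  have hmid : ∀ n, μ {ω | a₂ < |S.η (S.testIdx n) ω| ∧ |S.η (S.testIdx n) ω| ≤ b₂}
      ≤ ENNReal.ofReal (r / 2) := by
    intro n
    have hset : {ω | a₂ < |S.η (S.testIdx n) ω| ∧ |S.η (S.testIdx n) ω| ≤ b₂}
        = {ω | |S.η (S.testIdx n) ω| ≤ b₂} \ {ω | |S.η (S.testIdx n) ω| ≤ a₂} := by
      ext ω
      simp [and_comm]
    have hm : ∀ t, MeasurableSet {ω | |S.η (S.testIdx n) ω| ≤ t} := fun t =>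
      measurableSet_le (hS.measurable_η _).abs measurable_const
    have hsub : {ω | |S.η (S.testIdx n) ω| ≤ a₂} ⊆ {ω | |S.η (S.testIdx n) ω| ≤ b₂} :=
      fun ω (hω : |S.η (S.testIdx n) ω| ≤ a₂) => hω.trans (haq.trans hqb).le
    rw [hset, ← ofReal_measureReal, measureReal_sdiff hsub (hm a₂), ← hS.noiseCDF_eq,
      ← hS.noiseCDF_eq, ha₂, hb₂]
    exact ENNReal.ofReal_le_ofReal (by linarith)
  filter_upwards [ENNReal.tendsto_nhds_zero.1 hlim (ENNReal.ofReal (r / 2)) (by simpa using hr0')]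
    with n hn
  calc μ (symmDiff (S.covered S.wstar α n) (S.smallNoise q n))
      ≤ _ := ?_
    _ ≤ ENNReal.ofReal (r / 2) + ENNReal.ofReal (r / 2) := add_le_add hn (hmid n)
    _ = r := by rw [← ENNReal.ofReal_add (by positivity) (by positivity), add_halves]; simp
    _ ≤ δ := hrδ.le
  refine le_trans (measure_mono ?_) ((measure_union_le _ _).trans (add_le_add_left
    ((measure_union_le _ _).trans (add_le_add (measure_union_le _ _) (measure_union_le _ _))) _))
  intro ω hω
  rw [hS.covered_eq, Set.mem_symmDiff] at hω
  by_contra hcon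
  simp only [Set.mem_union, Set.mem_ofPred_eq, not_or, not_lt, not_le, not_and] at hcon
  obtain ⟨⟨⟨h1, h2⟩, h3, h4⟩, h5⟩ := hcon
  have h3' := (abs_lt.1 h3)
  have h4' := (abs_lt.1 h4)
  set η := |S.η (S.testIdx n) ω|
  rcases hω with ⟨hA, hB⟩ | ⟨hB, hA⟩
  · have hA' : S.score S.wstar n ω (S.X (S.testIdx n) ω) (S.Y n (S.testIdx n) ω)
      ≤ S.threshold (fun n j ω => S.score S.wstar n ω (S.X j ω) (S.Y n j ω)) α n ω := hA
    have hB' : q < η := not_le.1 hB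
    have h6 := h5 (haq.trans hB')
    have := mul_lt_mul_of_pos_left h6 hσ
    linarith [h4'.1]
  · have hA' : S.threshold (fun n j ω => S.score S.wstar n ω (S.X j ω) (S.Y n j ω)) α n ω
      < S.score S.wstar n ω (S.X (S.testIdx n) ω) (S.Y n (S.testIdx n) ω) := not_le.1 hA
    have hB' : η ≤ q := hB
    have h6 : η ≤ a₂ := by
      by_contra h
      linarith [h5 (not_le.1 h)]
    have := mul_le_mul_of_nonneg_left h6 hσ.le
    linarith [h3'.2]

/-- The conditional coverage given the leverage of the test point. -/
lemma ScaleFamilyModel.tendsto_condExp_covered (hS : S.ScaleFamilyModel μ)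
    (hR : S.Regular μ Fh) (hα : α ∈ Set.Ioo (0 : ℝ) 1) :
    Tendsto (fun n => ∫ ω, |(μ⟦S.covered S.wstar α n |
      MeasurableSpace.comap (S.htest n) inferInstance⟧) ω - (1 - α)| ∂μ) atTop (𝓝 0) := by
  obtain ⟨q, hq⟩ := hS.exists_noiseCDF_eq hR.cdf_cont (u := 1 - α)
    ⟨by linarith [hα.2], by linarith [hα.1]⟩
  have hlim := (ENNReal.tendsto_toReal ENNReal.zero_ne_top).comp (hS.tendsto_symmDiff hR hα hq)
  refine tendsto_of_tendsto_of_tendsto_of_le_of_le' tendsto_const_nhds hlim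
    (.of_forall fun n => integral_nonneg fun ω => abs_nonneg _) ?_
  filter_upwards [hS.eventually_measurableSet_covered hR hα] with n hn
  have hB : μ.real (S.smallNoise q n) = 1 - α := by rw [← hq, hS.noiseCDF_eq (S.testIdx n)]; rfl
  rw [← hB]
  exact integral_abs_condExp_sub_le (hS.measurable_htest n).comap_le
    (hS.measurable_η (S.testIdx n)).comap_le hn
    ⟨{x : ℝ | |x| ≤ q}, measurableSet_le measurable_abs measurable_const, rfl⟩
    (hS.indepFun_η_h n _ _)

lemma ScaleFamilyModel.tendsto_measure_covered (hS : S.ScaleFamilyModel μ)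
    (hR : S.Regular μ Fh) (hα : α ∈ Set.Ioo (0 : ℝ) 1) :
    Tendsto (fun n => μ.real (S.covered S.wstar α n)) atTop (𝓝 (1 - α)) := by
  obtain ⟨q, hq⟩ := hS.exists_noiseCDF_eq hR.cdf_cont (u := 1 - α)
    ⟨by linarith [hα.2], by linarith [hα.1]⟩
  have hlim := (ENNReal.tendsto_toReal ENNReal.zero_ne_top).comp (hS.tendsto_symmDiff hR hα hq)
  rw [tendsto_iff_norm_sub_tendsto_zero]
  refine tendsto_of_tendsto_of_tendsto_of_le_of_le' tendsto_const_nhds hlim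
    (.of_forall fun n => norm_nonneg _) ?_
  filter_upwards [hS.eventually_measurableSet_covered hR hα] with n hn
  have hB : μ.real (S.smallNoise q n) = 1 - α := by rw [← hq, hS.noiseCDF_eq (S.testIdx n)]; rfl
  rw [← hB, Real.norm_eq_abs]
  exact abs_measureReal_sub_le_measureReal_symmDiff hn.nullMeasurableSet
    (hS.measurableSet_smallNoise q n).nullMeasurableSet

/-- The limit law of the leverages is the point mass at zero. -/
lemma ScaleFamilyModel.ae_eq_zero [IsProbabilityMeasure Fh] (hS : S.ScaleFamilyModel μ)
    (hR : S.Regular μ Fh) : ∀ᵐ t ∂Fh, t = 0 := by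
  have hcont : Continuous fun t : ℝ => min |t| 1 := by fun_prop
  have hnn : ∀ t : ℝ, 0 ≤ min |t| 1 := fun t => le_min (abs_nonneg t) zero_le_one
  set φ : ℝ →ᵇ ℝ := BoundedContinuousFunction.ofNormedAddCommGroup (fun t => min |t| 1) hcont 1
    fun t => by rw [Real.norm_eq_abs, abs_of_nonneg (hnn t)]; exact min_le_right _ _ with hφ
  have hφ' : ∀ t, φ t = min |t| 1 := fun t => rfl
  have hint : ∫ t, φ t ∂Fh = 0 := by
    by_contra hne
    set I := ∫ t, φ t ∂Fh
    have hI : 0 < I := lt_of_le_of_ne (integral_nonneg fun t => hnn t) (Ne.symm hne)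
    -- If the integral `I` were positive, the empirical mean of `φ` would exceed `I / 2` with high
    -- probability. But all terms are below `I / 4` except for a fraction below `I / 4`, whose terms
    -- are at most `1`.
    have h1 := (tendstoInMeasure_iff_norm.1 (hR.leverage_weak φ)) (I / 2) (by positivity)
    have h2 := tendsto_bad_fraction (S := S) (μ := μ)
      (s := fun n j ω => S.h n ω (S.X j ω)) hR.n₂_tendsto (fun n j => hS.isMeasurable.h n j)
      (hS.uniformlySmall_h hR.n₁_tendsto) (ε := I / 4) (κ := I / 4) (by positivity)
      (by positivity)
    have h12 := h1.add h2
    rw [add_zero] at h12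
    obtain ⟨n, hn, hm⟩ := ((h12.eventually (gt_mem_nhds one_pos)).and
      (hR.n₂_tendsto.eventually_gt_atTop 0)).exists
    refine absurd hn (not_lt.2 ?_)
    rw [← measure_univ (μ := μ)]
    refine (measure_mono ?_).trans (measure_union_le _ _)
    intro ω _
    by_contra hcon
    simp only [Set.mem_union, Set.mem_ofPred_eq, not_or, not_le, Real.norm_eq_abs] at hcon
    have hm' : (0 : ℝ) < S.n₂ n := by exact_mod_cast hm
    have h3 := (abs_lt.1 hcon.1).1
    have h4 : ∑ i : Fin (S.n₂ n), φ (S.h n ω (S.X (S.n₁ n + i) ω))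
        ≤ ∑ i : Fin (S.n₂ n), (I / 4 + if I / 4 ≤ |S.h n ω (S.X (S.n₁ n + i) ω)| then 1 else 0) := by
      refine Finset.sum_le_sum fun i _ => ?_
      rw [hφ']
      split_ifs with hi
      · exact (min_le_right _ _).trans (by linarith)
      · exact (min_le_left _ _).trans (by linarith)
    rw [Finset.sum_add_distrib, Finset.sum_boole] at h4
    simp only [Finset.sum_const, Finset.card_univ, Fintype.card_fin, nsmul_eq_mul] at h4
    have h5 : (∑ i : Fin (S.n₂ n), φ (S.h n ω (S.X (S.n₁ n + i) ω))) / (S.n₂ n : ℝ) < I / 2 := by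
      rw [div_lt_iff₀ hm']
      linarith [hcon.2]
    linarith
  have hae := (integral_eq_zero_iff_of_nonneg (fun t => hnn t) (φ.integrable Fh)).1 hint
  filter_upwards [hae] with t ht
  have ht' : min |t| 1 = 0 := ht
  rcases min_choice |t| 1 with h | h
  · exact abs_eq_zero.1 (h ▸ ht')
  · rw [h] at ht'
    exact absurd ht' one_ne_zero

/-- The coverage given that the leverage of the test point is near zero. -/
lemma ScaleFamilyModel.tendsto_cond_covered (hS : S.ScaleFamilyModel μ) (hR : S.Regular μ Fh)
    (hα : α ∈ Set.Ioo (0 : ℝ) 1) {r : ℝ} (hr : 0 < r) :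
    (∀ᶠ n in atTop, 0 < μ {ω | |S.htest n ω - 0| < r}) ∧
      Tendsto (fun n => (μ[|{ω | |S.htest n ω - 0| < r}]).real (S.covered S.wstar α n))
        atTop (𝓝 (1 - α)) := by
  simp only [sub_zero]
  have hm : ∀ n, MeasurableSet {ω | |S.htest n ω| < r} := fun n =>
    measurableSet_lt (hS.measurable_htest n).abs measurable_const
  have hcompl : ∀ n, {ω | |S.htest n ω| < r}ᶜ = {ω | r ≤ |S.htest n ω|} := fun n => by
    ext ω
    simp
  have hsmall : Tendsto (fun n => μ.real {ω | |S.htest n ω| < r}ᶜ) atTop (𝓝 0) := by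
    simp only [hcompl]
    exact (ENNReal.tendsto_toReal ENNReal.zero_ne_top).comp
      ((hS.uniformlySmall_h hR.n₁_tendsto).tendsto (j := S.testIdx)
        (fun n => Nat.le_add_right _ _) hr)
  -- The conditioning event has probability tending to one, so conditioning on it does not change
  -- the limit.
  have hE : Tendsto (fun n => μ.real {ω | |S.htest n ω| < r}) atTop (𝓝 1) := by
    have := (tendsto_const_nhds (x := (1 : ℝ))).sub hsmall
    rw [sub_zero] at this
    refine this.congr fun n => ?_
    rw [probReal_compl_eq_one_sub (hm n)]
    ring
  refine ⟨?_, ?_⟩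
  · filter_upwards [hE.eventually (lt_mem_nhds one_pos)] with n hn
    exact (ENNReal.toReal_pos_iff.1 hn).1
  · have hinter : Tendsto (fun n => μ.real ({ω | |S.htest n ω| < r} ∩ S.covered S.wstar α n))
        atTop (𝓝 (1 - α)) := by
      have hA := hS.tendsto_measure_covered hR hα
      have hlow := hA.sub hsmall
      rw [sub_zero] at hlow
      refine tendsto_of_tendsto_of_tendsto_of_le_of_le hlow hA (fun n => ?_)
        fun n => measureReal_mono Set.inter_subset_right
      have : μ.real (S.covered S.wstar α n) ≤ μ.real ({ω | |S.htest n ω| < r} ∩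
          S.covered S.wstar α n) + μ.real {ω | |S.htest n ω| < r}ᶜ := by
        refine (measureReal_mono fun ω hω => ?_).trans (measureReal_union_le _ _)
        by_cases h : ω ∈ {ω | |S.htest n ω| < r}
        · exact .inl ⟨h, hω⟩
        · exact .inr h
      simp only
      linarith
    have hdiv := (hE.inv₀ one_ne_zero).mul hinter
    rw [inv_one, one_mul] at hdiv
    refine hdiv.congr fun n => ?_
    rw [measureReal_def (μ[|_]), cond_apply (hm n), ENNReal.toReal_mul, ENNReal.toReal_inv]
    rfl

/-- At the origin the prediction error vanishes and the noise scale cancels against the weight, so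
no approximation is involved. -/
lemma ScaleFamilyModel.coverageAt_zero (hS : S.ScaleFamilyModel μ) (n : ℕ) (ω : Ω) :
    S.coverageAt μ S.wstar α n ω 0 = S.noiseCDF μ (S.qhat S.wstar α n ω / S.σ) := by
  have hset : MeasurableSet {e : ℝ | |e| ≤ S.qhat S.wstar α n ω / S.σ} :=
    measurableSet_le measurable_abs measurable_const
  have hs : 0 < √(S.g (S.h n ω 0)) := hS.sqrt_g_pos n ω 0
  have hσ := hS.σ_pos
  have : {e | S.response n ω 0 e ∈ S.interval S.wstar α n ω 0}
      = {e : ℝ | |e| ≤ S.qhat S.wstar α n ω / S.σ} := by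
    ext e
    simp only [response, interval, fhat, wstar, inner_zero_left, zero_add, zero_sub, Set.mem_ofPred_eq,
      Set.mem_Icc, div_div_eq_mul_div, div_one]
    rw [← abs_le, abs_mul, abs_mul, abs_of_pos hσ, abs_of_pos hs, le_div_iff₀ hσ,
      show S.σ * √(S.g (S.h n ω 0)) * |e| = |e| * S.σ * √(S.g (S.h n ω 0)) by ring,
      mul_le_mul_iff_left₀ hs]
  rw [coverageAt, this, map_measureReal_apply (hS.measurable_η 0) hset, hS.noiseCDF_eq 0]
  rfl

/-- The coverage given the data and a test point of leverage zero. -/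
lemma ScaleFamilyModel.tendsto_coverageAt (hS : S.ScaleFamilyModel μ) (hR : S.Regular μ Fh)
    (hα : α ∈ Set.Ioo (0 : ℝ) 1) {ε : ℝ} (hε : 0 < ε) :
    Tendsto (fun n => μ {ω | ∃ x, S.h n ω x = 0 ∧
      ε ≤ |S.coverageAt μ S.wstar α n ω x - (1 - α)|}) atTop (𝓝 0) := by
  have h := hS.gram_invertible.add (hS.tendsto_noiseCDF_threshold hR.cdf_cont hR.n₂_tendsto
    (fun n j => hS.isMeasurable.score_wstar n j) hS.σ_pos (hS.uniformlySmall_score_wstar hR) hα hε)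
  rw [add_zero] at h
  refine tendsto_of_tendsto_of_tendsto_of_le_of_le tendsto_const_nhds h
    (fun n => zero_le) fun n => (measure_mono ?_).trans (measure_union_le _ _)
  rintro ω ⟨x, hx, hxε⟩
  by_cases hU : IsUnit (gram (S.design n ω))
  · right
    rw [eq_zero_of_leverage_eq_zero hU hx, hS.coverageAt_zero] at hxε
    exact hxε
  · left
    exact hU

end Setup

/-! ### From convergence in probability to convergence of expectations. -/

section Convergence

variable {Ω : Type*} [MeasurableSpace Ω] {μ : Measure Ω}

lemma tendsto_measure_abs_mul_sub {u v : ℕ → Ω → ℝ} {a b : ℝ}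
    (hu : ∀ ε : ℝ, 0 < ε → Tendsto (fun n => μ {ω | ε ≤ |u n ω - a|}) atTop (𝓝 0))
    (hv : ∀ ε : ℝ, 0 < ε → Tendsto (fun n => μ {ω | ε ≤ |v n ω - b|}) atTop (𝓝 0))
    {ε : ℝ} (hε : 0 < ε) :
    Tendsto (fun n => μ {ω | ε ≤ |u n ω * v n ω - a * b|}) atTop (𝓝 0) := by
  -- The bound `1` absorbs the product of the two deviations; the other bound makes all three error
  -- terms add up to at most `ε / 2`.
  set d := min 1 (ε / (2 * (1 + |a| + |b|))) with hd
  have hd0 : 0 < d := by positivity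
  have hd1 : d ≤ 1 := min_le_left _ _
  have hdε : d * (1 + |a| + |b|) ≤ ε / 2 := by
    have h := min_le_right 1 (ε / (2 * (1 + |a| + |b|)))
    rw [← hd, le_div_iff₀ (by positivity)] at h
    linarith
  have h := (hu d hd0).add (hv d hd0)
  rw [add_zero] at h
  refine tendsto_of_tendsto_of_tendsto_of_le_of_le tendsto_const_nhds h
    (fun n => zero_le) fun n => (measure_mono ?_).trans (measure_union_le _ _)
  intro ω (hω : ε ≤ |_|)
  by_contra hcon
  simp only [Set.mem_union, Set.mem_ofPred_eq, not_or, not_le] at hcon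
  obtain ⟨h1, h2⟩ := hcon
  have heq : u n ω * v n ω - a * b
      = (u n ω - a) * (v n ω - b) + a * (v n ω - b) + b * (u n ω - a) := by ring
  rw [heq] at hω
  have h3 := abs_add_three ((u n ω - a) * (v n ω - b)) (a * (v n ω - b)) (b * (u n ω - a))
  rw [abs_mul, abs_mul, abs_mul] at h3
  have h4 : |u n ω - a| * |v n ω - b| ≤ d * 1 :=
    mul_le_mul h1.le (h2.le.trans hd1) (abs_nonneg _) hd0.le
  have h5 := mul_le_mul_of_nonneg_left h2.le (abs_nonneg a)
  have h6 := mul_le_mul_of_nonneg_left h1.le (abs_nonneg b)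
  linarith

/-- Convergence of expectations: convergence in probability to a constant together with domination
up to a bounded term by variables of small expectation. -/
lemma tendsto_integral_of_dominated [IsProbabilityMeasure μ] {Z : ℕ → Ω → ℝ} {c : ℝ}
    (hZ : ∀ᶠ n in atTop, Measurable (Z n))
    (hprob : ∀ ε : ℝ, 0 < ε → Tendsto (fun n => μ {ω | ε ≤ |Z n ω - c|}) atTop (𝓝 0))
    (hdom : ∀ ε : ℝ, 0 < ε → ∃ M : ℝ, ∀ᶠ n in atTop, ∃ R : Ω → ℝ≥0∞,
      (∀ ω, ‖Z n ω‖ₑ ≤ ENNReal.ofReal M + R ω) ∧ ∫⁻ ω, R ω ∂μ ≤ ENNReal.ofReal ε) :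
    (∀ᶠ n in atTop, Integrable (Z n) μ) ∧ Tendsto (fun n => ∫ ω, Z n ω ∂μ) atTop (𝓝 c) := by
  have hL1 : Tendsto (fun n => ∫⁻ ω, ‖Z n ω - c‖ₑ ∂μ) atTop (𝓝 0) := by
    rw [ENNReal.tendsto_nhds_zero]
    intro δ hδ
    obtain ⟨r, hr0, hrδ⟩ := ENNReal.lt_iff_exists_nnreal_btwn.1 hδ
    have hr : (0 : ℝ) < r / 3 := by
      have : (0 : ℝ) < r := by exact_mod_cast hr0
      positivity
    obtain ⟨M, hM⟩ := hdom (r / 3) hr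
    have hbad : Tendsto (fun n => (ENNReal.ofReal M + ‖c‖ₑ) * μ {ω | (r : ℝ) / 3 ≤ |Z n ω - c|})
        atTop (𝓝 0) := by
      have := ENNReal.Tendsto.const_mul (a := ENNReal.ofReal M + ‖c‖ₑ) (hprob _ hr)
        (.inr (by simp))
      simpa using this
    filter_upwards [hM, hZ, ENNReal.tendsto_nhds_zero.1 hbad (ENNReal.ofReal (r / 3))
      (by simpa using hr)] with n ⟨R, hR, hRint⟩ hZn hbn
    set E := {ω | (r : ℝ) / 3 ≤ |Z n ω - c|} with hE
    have hEm : MeasurableSet E :=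
      measurableSet_le measurable_const (hZn.sub measurable_const).abs
    have hpt : ∀ ω, ‖Z n ω - c‖ₑ
        ≤ (ENNReal.ofReal (r / 3) + E.indicator (fun _ => ENNReal.ofReal M + ‖c‖ₑ) ω) + R ω := by
      intro ω
      by_cases hω : ω ∈ E
      · rw [Set.indicator_of_mem hω]
        calc ‖Z n ω - c‖ₑ ≤ ‖Z n ω‖ₑ + ‖c‖ₑ := enorm_sub_le
          _ ≤ (ENNReal.ofReal M + R ω) + ‖c‖ₑ := by gcongr; exact hR ω
          _ = (ENNReal.ofReal M + ‖c‖ₑ) + R ω := by ring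
          _ ≤ (ENNReal.ofReal (r / 3) + (ENNReal.ofReal M + ‖c‖ₑ)) + R ω :=
            add_le_add le_add_self le_rfl
      · rw [Real.enorm_eq_ofReal_abs]
        exact (ENNReal.ofReal_le_ofReal (not_le.1 hω).le).trans
          (le_self_add.trans le_self_add)
    calc ∫⁻ ω, ‖Z n ω - c‖ₑ ∂μ
        ≤ ∫⁻ ω, (ENNReal.ofReal (r / 3)
            + E.indicator (fun _ => ENNReal.ofReal M + ‖c‖ₑ) ω) + R ω ∂μ := lintegral_mono hpt
      _ = (ENNReal.ofReal (r / 3) + (ENNReal.ofReal M + ‖c‖ₑ) * μ E) + ∫⁻ ω, R ω ∂μ := by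
          -- Splitting the integral needs measurability of one summand only, so `R` may be
          -- arbitrary.
          have hm : Measurable fun ω => ENNReal.ofReal (r / 3)
              + E.indicator (fun _ => ENNReal.ofReal M + ‖c‖ₑ) ω :=
            (measurable_const.indicator hEm).const_add _
          rw [lintegral_add_left hm,
            lintegral_add_left measurable_const, lintegral_indicator_const hEm]
          simp
      _ ≤ (ENNReal.ofReal (r / 3) + ENNReal.ofReal (r / 3)) + ENNReal.ofReal (r / 3) := by gcongr
      _ = r := by
          rw [← ENNReal.ofReal_add hr.le hr.le, ← ENNReal.ofReal_add (by positivity) hr.le,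
            ← ENNReal.ofReal_coe_nnreal]
          congr 1
          ring
      _ ≤ δ := hrδ.le
  have hint : ∀ᶠ n in atTop, Integrable (Z n) μ := by
    filter_upwards [hZ, hL1.eventually (gt_mem_nhds one_pos)] with n hZn hn
    have : Integrable (fun ω => Z n ω - c) μ :=
      ⟨(hZn.sub measurable_const).aestronglyMeasurable, hn.trans ENNReal.one_lt_top⟩
    exact (integrable_add_const_iff (c := -c)).1 (by simpa only [sub_eq_add_neg] using this)
  refine ⟨hint, ?_⟩
  have := tendsto_integral_of_L1 (fun _ => c) (integrable_const c).aestronglyMeasurable hint hL1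
  simpa using this

end Convergence

/-! ### Domination of the thresholds and width parity. -/

namespace Setup

variable {Ω : Type*} {p : ℕ} {S : Setup Ω p} [MeasurableSpace Ω] {μ : Measure Ω}
  {Fh : Measure ℝ} {α : ℝ}

/-- A threshold is dominated if the scores are. -/
lemma exists_dominating_threshold (hn₂ : Tendsto S.n₂ atTop atTop)
    (hα : α ∈ Set.Ioo (0 : ℝ) 1) {s : ℕ → ℕ → Ω → ℝ} (hs : ∀ n j ω, 0 ≤ s n j ω)
    {v : ℕ → Ω → ℝ} (hv : ∀ n ω, 0 ≤ v n ω)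
    (h : ∀ ε : ℝ, 0 < ε → ∃ M : ℝ, ∀ᶠ n in atTop, ∀ j, S.n₁ n ≤ j → ∃ r : Ω → ℝ≥0∞,
      Measurable r ∧ (∀ ω, ENNReal.ofReal (s n j ω * v n ω) ≤ ENNReal.ofReal M + r ω) ∧
      ∫⁻ ω, r ω ∂μ ≤ ENNReal.ofReal ε) {ε : ℝ} (hε : 0 < ε) :
    ∃ M : ℝ, ∀ᶠ n in atTop, ∃ R : Ω → ℝ≥0∞,
      (∀ ω, ‖S.threshold s α n ω * v n ω‖ₑ ≤ ENNReal.ofReal M + R ω) ∧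
      ∫⁻ ω, R ω ∂μ ≤ ENNReal.ofReal ε := by
  have hα0 : 0 < α := hα.1
  -- A fraction `α / 2` of the scores lies above the rank, so the threshold is at most `2 / α` times
  -- the mean score; the factor `α / 2` compensates for this.
  obtain ⟨M, hM⟩ := h (α / 2 * ε) (by positivity)
  refine ⟨2 / α * M, ?_⟩
  filter_upwards [hM, hn₂.eventually_gt_atTop 0,
    hn₂.eventually (eventually_rank_le hα (half_pos hα0))] with n hn hm hrank
  choose! r hrm hr hrint using hn
  have hm' : (0 : ℝ) < S.n₂ n := by exact_mod_cast hm
  have hC : 0 ≤ 1 / (α / 2 * S.n₂ n) := by positivity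
  have hCm : ENNReal.ofReal (1 / (α / 2 * S.n₂ n)) * (S.n₂ n : ℝ≥0∞) = ENNReal.ofReal (2 / α) := by
    rw [← ENNReal.ofReal_natCast, ← ENNReal.ofReal_mul hC]
    congr 1
    field_simp
  refine ⟨fun ω => ENNReal.ofReal (1 / (α / 2 * S.n₂ n))
    * ∑ i : Fin (S.n₂ n), r (S.n₁ n + i) ω, fun ω => ?_, ?_⟩
  · have h0 : 0 ≤ S.threshold s α n ω :=
      kthSmallest_nonneg (fun i => hs n _ ω) (one_le_rank hα.2 _)
    have h1 : S.threshold s α n ω ≤ (∑ i : Fin (S.n₂ n), s n (S.n₁ n + i) ω) / (α / 2 * S.n₂ n) :=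
      kthSmallest_le_sum (fun i => hs n _ ω) (one_le_rank hα.2 _) (half_pos hα0) hm
        (by linarith)
    have h2 : S.threshold s α n ω * v n ω
        ≤ 1 / (α / 2 * S.n₂ n) * ∑ i : Fin (S.n₂ n), s n (S.n₁ n + i) ω * v n ω := by
      rw [← Finset.sum_mul, one_div_mul_eq_div, mul_div_right_comm]
      exact mul_le_mul_of_nonneg_right h1 (hv n ω)
    rw [Real.enorm_eq_ofReal (mul_nonneg h0 (hv n ω))]
    calc ENNReal.ofReal (S.threshold s α n ω * v n ω)
        ≤ ENNReal.ofReal (1 / (α / 2 * S.n₂ n))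
          * ∑ i : Fin (S.n₂ n), ENNReal.ofReal (s n (S.n₁ n + i) ω * v n ω) := by
          rw [← ENNReal.ofReal_sum_of_nonneg fun i _ => mul_nonneg (hs n _ ω) (hv n ω),
            ← ENNReal.ofReal_mul hC]
          exact ENNReal.ofReal_le_ofReal h2
      _ ≤ ENNReal.ofReal (1 / (α / 2 * S.n₂ n))
          * ∑ i : Fin (S.n₂ n), (ENNReal.ofReal M + r (S.n₁ n + i) ω) := by
          gcongr with i
          exact hr _ (Nat.le_add_right _ _) ω
      _ = _ := by
          rw [Finset.sum_add_distrib, mul_add, ENNReal.ofReal_mul (by positivity), ← hCm]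
          simp [mul_assoc]
  · rw [lintegral_const_mul _ (Finset.measurable_sum _ fun i _ => hrm _ (Nat.le_add_right _ _)),
      lintegral_finsetSum _ fun i _ => hrm _ (Nat.le_add_right _ _)]
    calc ENNReal.ofReal (1 / (α / 2 * S.n₂ n)) * ∑ i : Fin (S.n₂ n), ∫⁻ ω, r (S.n₁ n + i) ω ∂μ
        ≤ ENNReal.ofReal (1 / (α / 2 * S.n₂ n))
          * ∑ _i : Fin (S.n₂ n), ENNReal.ofReal (α / 2 * ε) := by
          gcongr with i
          exact hrint _ (Nat.le_add_right _ _)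
      _ = ENNReal.ofReal ε := by
          simp only [Finset.sum_const, Finset.card_univ, Fintype.card_fin, nsmul_eq_mul]
          rw [← mul_assoc, hCm, ← ENNReal.ofReal_mul (by positivity)]
          congr 1
          field_simp

lemma ScaleFamilyModel.score_wstar_nonneg (hS : S.ScaleFamilyModel μ) (n j : ℕ) (ω : Ω) :
    0 ≤ S.score S.wstar n ω (S.X j ω) (S.Y n j ω) :=
  mul_nonneg (abs_nonneg _) (one_div_pos.2 (hS.sqrt_g_pos n ω _)).le

lemma ScaleFamilyModel.measurable_g_max (hS : S.ScaleFamilyModel μ) :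
    Measurable fun t => S.g (max t 0) :=
  (hS.g_cont.comp_continuous (by fun_prop) fun t => le_max_right t 0).measurable

lemma ScaleFamilyModel.lintegral_sq_η (hS : S.ScaleFamilyModel μ) (i : ℕ) :
    ∫⁻ ω, ENNReal.ofReal (S.η i ω ^ 2) ∂μ = 1 := by
  have hm : Measurable fun x : ℝ => ENNReal.ofReal (x ^ 2) := by fun_prop
  have h := ((hS.ident_η i).comp hm).lintegral_eq
  refine h.trans ?_
  simp only [Function.comp_apply]
  rw [← ofReal_integral_eq_lintegral_ofReal hS.memLp_η.integrable_sq
    (.of_forall fun ω => sq_nonneg _)]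
  rw [← variance_of_integral_eq_zero (hS.measurable_η 0).aemeasurable hS.mean_η, hS.var_η]
  simp

/-- Noise of unit second moment is independent of the leverages. The two indices are separate
because the weighted width pairs calibration noise with the scale of the test point. -/
lemma ScaleFamilyModel.lintegral_g_mul_sq_η (hS : S.ScaleFamilyModel μ) (n i j : ℕ) :
    ∫⁻ ω, ENNReal.ofReal (S.g (S.h n ω (S.X j ω))) * ENNReal.ofReal (S.η i ω ^ 2) ∂μ
      = ∫⁻ ω, ENNReal.ofReal (S.g (S.h n ω (S.X j ω))) ∂μ := by
  have hm : Measurable fun x : ℝ => ENNReal.ofReal (x ^ 2) := by fun_prop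
  have hind := (hS.indepFun_η_h n i j).symm.comp hS.measurable_g_max.ennreal_ofReal hm
  have heq : (fun t => ENNReal.ofReal (S.g (max t 0))) ∘ (fun ω => S.h n ω (S.X j ω))
      = fun ω => ENNReal.ofReal (S.g (S.h n ω (S.X j ω))) := by
    funext ω
    simp [max_eq_left (S.h_nonneg n ω (S.X j ω))]
  rw [heq] at hind
  have := lintegral_mul_eq_lintegral_mul_lintegral_of_indepFun
    (hS.isMeasurable.g_h n j).ennreal_ofReal (hm.comp (hS.measurable_η i)) hind
  refine this.trans ?_
  have h1 := hS.lintegral_sq_η i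
  simp only [Function.comp_def]
  rw [h1, mul_one]

variable [IsProbabilityMeasure μ]

/-- Transfers the moment assumption, made at the test point only, to the calibration points. -/
lemma ScaleFamilyModel.lintegral_g_eq (hS : S.ScaleFamilyModel μ) (n : ℕ) {j : ℕ}
    (hj : S.n₁ n ≤ j) : ∫⁻ ω, ENNReal.ofReal (S.g (S.h n ω (S.X j ω))) ∂μ
      = ∫⁻ ω, ENNReal.ofReal (S.g (S.htest n ω)) ∂μ := by
  have h := ((hS.identDistrib_h n hj (Nat.le_add_right _ (S.n₂ n))).comp
    hS.measurable_g_max.ennreal_ofReal).lintegral_eq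
  simp only [Function.comp_apply, max_eq_left (S.h_nonneg n _ _)] at h
  exact h

lemma ScaleFamilyModel.lintegral_sq_error_eq (hS : S.ScaleFamilyModel μ) (n : ℕ) {j : ℕ}
    (hj : S.n₁ n ≤ j) :
    ∫⁻ ω, ENNReal.ofReal ((inner ℝ (S.X j ω) (S.βhat n ω - S.βstar)) ^ 2) ∂μ
      = ∫⁻ ω, ENNReal.ofReal ((inner ℝ (S.Xtest n ω) (S.βhat n ω - S.βstar)) ^ 2) ∂μ := by
  have hm : Measurable fun x : ℝ => ENNReal.ofReal (x ^ 2) := by fun_prop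
  exact ((hS.identDistrib_error n hj (Nat.le_add_right _ (S.n₂ n))).comp hm).lintegral_eq

/-- Since `x ≤ K + x ^ 2 / K`, bounded second moments of the scores make the excess over `K` small
in expectation for large `K`. -/
lemma ScaleFamilyModel.exists_dominating_score_one (hS : S.ScaleFamilyModel μ)
    (hW : S.WidthRegular μ α) {ε : ℝ} (hε : 0 < ε) :
    ∃ M : ℝ, ∀ᶠ n in atTop, ∀ j, S.n₁ n ≤ j → ∃ r : Ω → ℝ≥0∞, Measurable r ∧
      (∀ ω, ENNReal.ofReal (S.score (fun _ => 1) n ω (S.X j ω) (S.Y n j ω) * 1)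
        ≤ ENNReal.ofReal M + r ω) ∧ ∫⁻ ω, r ω ∂μ ≤ ENNReal.ofReal ε := by
  obtain ⟨B₀, hB₀⟩ := hW.noise_variance_bounded
  set B := max B₀ 0 with hB
  have hB0 : 0 ≤ B := le_max_right _ _
  set K := (2 + 2 * S.σ ^ 2 * B) / ε with hK
  have hK0 : 0 < K := by positivity
  refine ⟨K, ?_⟩
  filter_upwards [hB₀, ENNReal.tendsto_nhds_zero.1 hW.prediction_error 1 one_pos]
    with n hBn hEn j hj
  set e : Ω → ℝ := fun ω => inner ℝ (S.X j ω) (S.βhat n ω - S.βstar) with he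
  have hem : Measurable e := hS.isMeasurable.error n j
  have hgm := (hS.isMeasurable.g_h n j).ennreal_ofReal
  have hηm : Measurable fun ω => ENNReal.ofReal (S.η j ω ^ 2) :=
    ((hS.measurable_η j).pow_const 2).ennreal_ofReal
  have hgηm : Measurable fun ω => ENNReal.ofReal (S.g (S.h n ω (S.X j ω)))
      * ENNReal.ofReal (S.η j ω ^ 2) := hgm.mul hηm
  have hem' : Measurable fun ω => ENNReal.ofReal (e ω ^ 2) := (hem.pow_const 2).ennreal_ofReal
  refine ⟨fun ω => ENNReal.ofReal (2 / K) * ENNReal.ofReal (e ω ^ 2)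
    + ENNReal.ofReal (2 * S.σ ^ 2 / K) * (ENNReal.ofReal (S.g (S.h n ω (S.X j ω)))
      * ENNReal.ofReal (S.η j ω ^ 2)),
    (hem'.const_mul _).add (hgηm.const_mul _), fun ω => ?_, ?_⟩
  · have hg0 : 0 ≤ S.g (S.h n ω (S.X j ω)) :=
      hS.g_zero.le.trans (hS.g_zero_le (S.h_nonneg n ω _))
    beta_reduce
    rw [← ENNReal.ofReal_mul hg0, ← ENNReal.ofReal_mul (by positivity),
      ← ENNReal.ofReal_mul (by positivity), ← ENNReal.ofReal_add (by positivity) (by positivity),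
      ← ENNReal.ofReal_add hK0.le (by positivity)]
    refine ENNReal.ofReal_le_ofReal ?_
    rw [score, S.residual_eq, mul_one, mul_one]
    change |S.σ * √(S.g (S.h n ω (S.X j ω))) * S.η j ω - e ω| ≤ _
    set g := S.g (S.h n ω (S.X j ω))
    set x := |S.σ * √g * S.η j ω - e ω| with hx
    have h1 : x ≤ K + x ^ 2 / K := by
      rw [← sub_nonneg, show K + x ^ 2 / K - x = (K ^ 2 + x ^ 2 - x * K) / K by field_simp]
      exact div_nonneg (by nlinarith [sq_nonneg (K - x), sq_nonneg (K + x)]) hK0.le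
    have h2 : x ^ 2 ≤ 2 * e ω ^ 2 + 2 * S.σ ^ 2 * (g * S.η j ω ^ 2) := by
      rw [hx, sq_abs]
      have h3 : (S.σ * √g * S.η j ω) ^ 2 = S.σ ^ 2 * (g * S.η j ω ^ 2) := by
        rw [mul_pow, mul_pow, Real.sq_sqrt hg0]; ring
      nlinarith [sq_nonneg (S.σ * √g * S.η j ω + e ω)]
    calc x ≤ K + x ^ 2 / K := h1
      _ ≤ K + (2 * e ω ^ 2 + 2 * S.σ ^ 2 * (g * S.η j ω ^ 2)) / K := by gcongr
      _ = _ := by ring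
  · rw [lintegral_add_left (hem'.const_mul _), lintegral_const_mul _ hem',
      lintegral_const_mul _ hgηm, hS.lintegral_g_mul_sq_η, hS.lintegral_g_eq n hj]
    simp only [he]
    rw [hS.lintegral_sq_error_eq n hj]
    calc _ ≤ ENNReal.ofReal (2 / K) * 1 + ENNReal.ofReal (2 * S.σ ^ 2 / K) * ENNReal.ofReal B := by
          gcongr
          exact hBn.trans (ENNReal.ofReal_le_ofReal (le_max_left _ _))
      _ = ENNReal.ofReal ε := by
          rw [mul_one, ← ENNReal.ofReal_mul (by positivity),
            ← ENNReal.ofReal_add (by positivity) (by positivity)]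
          congr 1
          rw [hK]
          field_simp

/-- Young's inequality is applied separately to the error and noise parts of the score times the
test scale. In the error part the large factor `K` falls on the squared error, whose expectation
vanishes; in the noise part it falls on a constant. -/
lemma ScaleFamilyModel.exists_dominating_score_wstar (hS : S.ScaleFamilyModel μ)
    (hW : S.WidthRegular μ α) {ε : ℝ} (hε : 0 < ε) :
    ∃ M : ℝ, ∀ᶠ n in atTop, ∀ j, S.n₁ n ≤ j → ∃ r : Ω → ℝ≥0∞, Measurable r ∧
      (∀ ω, ENNReal.ofReal (S.score S.wstar n ω (S.X j ω) (S.Y n j ω)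
        * √(S.g (S.htest n ω))) ≤ ENNReal.ofReal M + r ω) ∧
      ∫⁻ ω, r ω ∂μ ≤ ENNReal.ofReal ε := by
  obtain ⟨B₀, hB₀⟩ := hW.noise_variance_bounded
  set B := max B₀ 0 with hB
  have hB0 : 0 ≤ B := le_max_right _ _
  have hg00 := hS.g_zero
  -- Chosen so that the terms divided by `K` contribute at most `ε / 2`; the summand `1` in `B + 1`
  -- keeps `K` positive when `B = 0`.
  set K := 2 * (1 + S.σ ^ 2) * (B + 1) / ε with hK
  have hK0 : 0 < K := by positivity
  refine ⟨K, ?_⟩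
  have hpos : 0 < S.g 0 * (ε / 2) / K := by positivity
  filter_upwards [hB₀, ENNReal.tendsto_nhds_zero.1 hW.prediction_error
    (ENNReal.ofReal (S.g 0 * (ε / 2) / K)) (by simpa using hpos)] with n hBn hEn j hj
  set e : Ω → ℝ := fun ω => inner ℝ (S.X j ω) (S.βhat n ω - S.βstar) with he
  have hem : Measurable e := hS.isMeasurable.error n j
  have hgm : Measurable fun ω => ENNReal.ofReal (S.g (S.htest n ω)) :=
    (hS.isMeasurable.g_h n (S.testIdx n)).ennreal_ofReal
  have hηm : Measurable fun ω => ENNReal.ofReal (S.η j ω ^ 2) :=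
    ((hS.measurable_η j).pow_const 2).ennreal_ofReal
  have hgηm : Measurable fun ω => ENNReal.ofReal (S.g (S.htest n ω))
      * ENNReal.ofReal (S.η j ω ^ 2) := hgm.mul hηm
  have hem' : Measurable fun ω => ENNReal.ofReal (e ω ^ 2) := (hem.pow_const 2).ennreal_ofReal
  refine ⟨fun ω => ENNReal.ofReal (K / S.g 0) * ENNReal.ofReal (e ω ^ 2)
    + (ENNReal.ofReal (1 / K) * ENNReal.ofReal (S.g (S.htest n ω))
      + ENNReal.ofReal (S.σ ^ 2 / K) * (ENNReal.ofReal (S.g (S.htest n ω))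
      * ENNReal.ofReal (S.η j ω ^ 2))),
    (hem'.const_mul _).add ((hgm.const_mul _).add (hgηm.const_mul _)), fun ω => ?_, ?_⟩
  · have hg0 : 0 ≤ S.g (S.htest n ω) := hS.g_zero.le.trans (hS.g_zero_le (S.h_nonneg n ω _))
    beta_reduce
    rw [← ENNReal.ofReal_mul hg0, ← ENNReal.ofReal_mul (by positivity),
      ← ENNReal.ofReal_mul (by positivity), ← ENNReal.ofReal_mul (by positivity),
      ← ENNReal.ofReal_add (by positivity) (by positivity),
      ← ENNReal.ofReal_add (by positivity) (by positivity),
      ← ENNReal.ofReal_add hK0.le (by positivity)]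
    refine ENNReal.ofReal_le_ofReal ?_
    have hsc := (abs_le.1 (hS.abs_score_wstar_sub_le n j ω)).2
    set sc := S.score S.wstar n ω (S.X j ω) (S.Y n j ω)
    set g := S.g (S.htest n ω)
    have hsq : √g ^ 2 = g := Real.sq_sqrt hg0
    have hsq0 : √(S.g 0) ^ 2 = S.g 0 := Real.sq_sqrt hg00.le
    have hyoung : ∀ x y : ℝ, x * y ≤ K * x ^ 2 + y ^ 2 / K := by
      intro x y
      rw [← sub_nonneg, show K * x ^ 2 + y ^ 2 / K - x * y
        = ((K * x) ^ 2 + y ^ 2 - K * x * y) / K by field_simp]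
      exact div_nonneg (by nlinarith [sq_nonneg (K * x - y), sq_nonneg (K * x + y)]) hK0.le
    have h1 := hyoung (|e ω| / √(S.g 0)) √g
    have h2 := hyoung 1 (S.σ * |S.η j ω| * √g)
    rw [div_pow, sq_abs, hsq0, hsq] at h1
    rw [mul_pow, mul_pow, sq_abs, hsq, one_pow, one_mul, mul_one] at h2
    have h3 : sc * √g ≤ (|e ω| / √(S.g 0) + S.σ * |S.η j ω|) * √g :=
      mul_le_mul_of_nonneg_right (by linarith) (Real.sqrt_nonneg _)
    calc sc * √g ≤ |e ω| / √(S.g 0) * √g + S.σ * |S.η j ω| * √g := by linarith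
      _ ≤ (K * (e ω ^ 2 / S.g 0) + g / K) + (K + S.σ ^ 2 * S.η j ω ^ 2 * g / K) :=
        add_le_add h1 h2
      _ = _ := by ring
  · have hgη : ∫⁻ ω, ENNReal.ofReal (S.g (S.htest n ω)) * ENNReal.ofReal (S.η j ω ^ 2) ∂μ
        = ∫⁻ ω, ENNReal.ofReal (S.g (S.htest n ω)) ∂μ := hS.lintegral_g_mul_sq_η n j _
    rw [lintegral_add_left (hem'.const_mul _), lintegral_add_left (hgm.const_mul _),
      lintegral_const_mul _ hem', lintegral_const_mul _ hgm,
      lintegral_const_mul _ hgηm, hgη]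
    simp only [he]
    rw [hS.lintegral_sq_error_eq n hj]
    have hBn' := hBn.trans (ENNReal.ofReal_le_ofReal (le_max_left B₀ 0))
    calc _ ≤ ENNReal.ofReal (K / S.g 0) * ENNReal.ofReal (S.g 0 * (ε / 2) / K)
          + (ENNReal.ofReal (1 / K) * ENNReal.ofReal B
            + ENNReal.ofReal (S.σ ^ 2 / K) * ENNReal.ofReal B) := by gcongr
      _ = ENNReal.ofReal (ε / 2 + (1 + S.σ ^ 2) * B / K) := by
          rw [← ENNReal.ofReal_mul (by positivity), ← ENNReal.ofReal_mul (by positivity),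
            ← ENNReal.ofReal_mul (by positivity), ← ENNReal.ofReal_add (by positivity)
            (by positivity), ← ENNReal.ofReal_add (by positivity) (by positivity)]
          congr 1
          field_simp
      _ ≤ ENNReal.ofReal ε := by
          refine ENNReal.ofReal_le_ofReal ?_
          have : (1 + S.σ ^ 2) * B / K ≤ ε / 2 := by
            rw [div_le_iff₀ hK0, hK]
            have : ε / 2 * (2 * (1 + S.σ ^ 2) * (B + 1) / ε) = (1 + S.σ ^ 2) * (B + 1) := by
              field_simp
            rw [this]
            gcongr
            linarith
          linarith

/-- Width parity. -/
lemma ScaleFamilyModel.width_parity (hS : S.ScaleFamilyModel μ) (hR : S.Regular μ Fh)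
    (hα : α ∈ Set.Ioo (0 : ℝ) 1) (hW : S.WidthRegular μ α) :
    (∀ᶠ n in atTop,
      Integrable (fun ω => S.width S.wstar α n ω (S.Xtest n ω)) μ ∧
      Integrable (fun ω => S.width (fun _ => 1) α n ω (S.Xtest n ω)) μ ∧
      0 < ∫ ω, S.width (fun _ => 1) α n ω (S.Xtest n ω) ∂μ) ∧
    Tendsto (fun n => (∫ ω, S.width S.wstar α n ω (S.Xtest n ω) ∂μ) /
      ∫ ω, S.width (fun _ => 1) α n ω (S.Xtest n ω) ∂μ) atTop (𝓝 1) := by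
  obtain ⟨q, hq, hq'⟩ := hW.quantile_unique
  change S.noiseCDF μ q = 1 - α at hq
  change ∀ t, S.noiseCDF μ t = 1 - α → t = q at hq'
  have hη := hR.cdf_cont
  have hσ := hS.σ_pos
  have hg0 : 0 < √(S.g 0) := Real.sqrt_pos.2 hS.g_zero
  -- Positivity of the quantile makes the common limit of the widths nonzero, so that the ratio
  -- converges.
  have hqpos : 0 < q := by
    by_contra hle
    rw [hS.noiseCDF_of_nonpos hη (not_lt.1 hle)] at hq
    linarith [hα.2]
  have hsw := fun n j => hS.isMeasurable.score_wstar n j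
  have hs1 := fun n j => hS.isMeasurable.score_one n j
  have hscale : ∀ ε : ℝ, 0 < ε →
      Tendsto (fun n => μ {ω | ε ≤ |√(S.g (S.htest n ω)) - √(S.g 0)|}) atTop (𝓝 0) :=
    fun ε hε => (hS.uniformlySmall_scale hR).tendsto (j := S.testIdx)
      (fun n => Nat.le_add_right _ _) hε
  have hgm : ∀ n, Measurable fun ω => √(S.g (S.htest n ω)) := fun n =>
    (hS.isMeasurable.g_h n (S.testIdx n)).sqrt
  obtain ⟨hiw, hlw⟩ := tendsto_integral_of_dominated
    (Z := fun n ω => S.threshold (fun n j ω => S.score S.wstar n ω (S.X j ω) (S.Y n j ω)) α n ω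
      * √(S.g (S.htest n ω))) (c := S.σ * q * √(S.g 0)) (μ := μ)
    ((eventually_measurable_threshold hR.n₂_tendsto hα hsw).mono fun n hn => hn.mul (hgm n))
    (fun ε hε => tendsto_measure_abs_mul_sub (fun ε hε => hS.tendsto_threshold hη hR.n₂_tendsto
      hsw hσ (hS.uniformlySmall_score_wstar hR) hα hq hq' hε) hscale hε)
    (fun ε hε => exists_dominating_threshold hR.n₂_tendsto hα hS.score_wstar_nonneg
      (fun n ω => Real.sqrt_nonneg _) (fun ε hε => hS.exists_dominating_score_wstar hW hε) hε)
  obtain ⟨hi1, hl1⟩ := tendsto_integral_of_dominated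
    (Z := fun n ω => S.threshold (fun n j ω => S.score (fun _ => 1) n ω (S.X j ω) (S.Y n j ω))
      α n ω * 1) (c := S.σ * √(S.g 0) * q) (μ := μ)
    ((eventually_measurable_threshold hR.n₂_tendsto hα hs1).mono fun n hn =>
      hn.mul measurable_const)
    (fun ε hε => by
      simp only [mul_one]
      exact hS.tendsto_threshold hη hR.n₂_tendsto hs1 (mul_pos hσ hg0)
        (hS.uniformlySmall_score_one hR) hα hq hq' hε)
    (fun ε hε => exists_dominating_threshold hR.n₂_tendsto hα
      (fun n j ω => mul_nonneg (abs_nonneg _) zero_le_one)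
      (v := fun _ _ => 1) (fun n ω => zero_le_one)
      (fun ε hε => hS.exists_dominating_score_one hW hε) hε)
  have hww : ∀ n ω, S.width S.wstar α n ω (S.Xtest n ω)
      = 2 * (S.threshold (fun n j ω => S.score S.wstar n ω (S.X j ω) (S.Y n j ω)) α n ω
        * √(S.g (S.htest n ω))) := by
    intro n ω
    rw [width, wstar, div_div_eq_mul_div, div_one, mul_assoc]
    rfl
  have hw1 : ∀ n ω, S.width (fun _ => 1) α n ω (S.Xtest n ω)
      = 2 * (S.threshold (fun n j ω => S.score (fun _ => 1) n ω (S.X j ω) (S.Y n j ω)) α n ω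
        * 1) := by
    intro n ω
    rw [width, div_one, mul_one]
    rfl
  -- The factor `√(g 0)` comes from the scale of the test point for `wstar` and from the threshold
  -- itself for the constant weight; the limits agree.
  have hc : S.σ * q * √(S.g 0) = S.σ * √(S.g 0) * q := by ring
  rw [hc] at hlw
  have hcpos : 0 < S.σ * √(S.g 0) * q := by positivity
  simp only [hww, hw1, integral_const_mul]
  refine ⟨?_, ?_⟩
  · filter_upwards [hiw, hi1, hl1.eventually (lt_mem_nhds hcpos)] with n h1 h2 h3
    exact ⟨h1.const_mul 2, h2.const_mul 2, by linarith⟩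
  · have := (hlw.const_mul 2).div (hl1.const_mul 2) (by positivity)
    rwa [div_self (by positivity)] at this

end Setup

end LWCP

end

theorem mainTheorem2 {Ω : Type*} [MeasurableSpace Ω] (μ : Measure Ω) [IsProbabilityMeasure μ]
    {p : ℕ} (S : LWCP.Setup Ω p) (Fh : Measure ℝ) [IsProbabilityMeasure Fh]
    (α : ℝ) (hα : α ∈ Set.Ioo (0 : ℝ) 1)
    (hmodel : S.ScaleFamilyModel μ) (hreg : S.Regular μ Fh) :
    -- Conditional coverage given the leverage of the test point: as a conditional probability,
    Tendsto (fun n => ∫ ω, |(μ⟦S.covered S.wstar α n | MeasurableSpace.comap (S.htest n) inferInstance⟧) ω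
      - (1 - α)| ∂μ) atTop (𝓝 0) ∧
    -- given that the leverage is close to `t`, for `Fh`-almost every `t`,
    (∀ᵐ t ∂Fh, ∀ r : ℝ, 0 < r →
      (∀ᶠ n in atTop, 0 < μ {ω | |S.htest n ω - t| < r}) ∧
      Tendsto (fun n => (μ[|{ω | |S.htest n ω - t| < r}]).real (S.covered S.wstar α n))
        atTop (𝓝 (1 - α))) ∧
    -- and given the data and a test feature vector of leverage exactly `t`, uniformly in the
    -- latter, in probability, for `Fh`-almost every `t`.
    (∀ᵐ t ∂Fh, ∀ ε : ℝ, 0 < ε →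
      Tendsto (fun n => μ {ω | ∃ x, S.h n ω x = t ∧
        ε ≤ |S.coverageAt μ S.wstar α n ω x - (1 - α)|}) atTop (𝓝 0)) ∧
    -- Width parity
    (S.WidthRegular μ α →
      (∀ᶠ n in atTop,
        Integrable (fun ω => S.width S.wstar α n ω (S.Xtest n ω)) μ ∧
        Integrable (fun ω => S.width (fun _ => 1) α n ω (S.Xtest n ω)) μ ∧
        0 < ∫ ω, S.width (fun _ => 1) α n ω (S.Xtest n ω) ∂μ) ∧
      Tendsto (fun n => (∫ ω, S.width S.wstar α n ω (S.Xtest n ω) ∂μ) /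
        ∫ ω, S.width (fun _ => 1) α n ω (S.Xtest n ω) ∂μ) atTop (𝓝 1)) := by
  refine ⟨hmodel.tendsto_condExp_covered hreg hα, ?_, ?_, hmodel.width_parity hreg hα⟩
  -- The limit law charges only zero, so `t = 0` is the only value to treat.
  · filter_upwards [hmodel.ae_eq_zero hreg] with t ht r hr
    rw [ht]
    exact hmodel.tendsto_cond_covered hreg hα hr
  · filter_upwards [hmodel.ae_eq_zero hreg] with t ht ε hε
    rw [ht]
    exact hmodel.tendsto_coverageAt hreg hα hε
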